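/- Let $k_r(G)$ denote the number of $r$-cliques (complete subgraphs on $r$ vertices) of a graph $G$, and let $k_r(n,m)$ be the minimum of $k_r(G)$ over all graphs $G$ with $n$ vertices and $m$ edges. For $0<c<1/2$ set $\xi(c)=\lceil 1/(1-2c)\rceil$ and, with $s=\xi(c)$, $$x=\frac1s+\frac1s\sqrt{1-\frac{2s}{s-1}c},\qquad y=\frac1s-\frac{s-1}{s}\sqrt{1-\frac{2s}{s-1}c}.$$ For a real symmetric $s\times s$ matrix $A=(a_{ij})$ and $\mathbf z\in\mathbb R^s$ put $$L_r(A,\mathbf z)=\sum_{X\subseteq[s],\,|X|=r}\ \prod_{i,j\in X,\,i<j}a_{ij}\prod_{i\in X}z_i,$$ and let $\varphi_r(c)=L_r(A_s,\mathbf x_c)$, where $A_s$ is the $s\times s$ matrix with zero diagonal and all off-diagonal entries equal to $1$, and $\mathbf x_c=(x,\ldots,x,y)\in\mathbb R^s$. (i) Let $r\in\{3,4\}$, let $G$ be a graph with $n$ vertices and $m\ge 1$ edges, and let $s=\lceil 1/(1-2m/n^2)\rceil$. Then $k_r(G)\ge\varphi_r(m/n^2)\,n^r$, and $$\varphi_r\!\left(\frac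 m{n^2}\right)n^r=\binom sr\frac1{s^r}\left(n-(r-1)\sqrt{n^2-\frac{2sm}{s-1}}\right)\left(n+\sqrt{n^2-\frac{2sm}{s-1}}\right)^{r-1}.$$ (ii) For $r=3$ and $n\ge1$, $n^2/4\le m\le n^2/3$, this is Fisher's bound: $$\varphi_3\!\left(\frac m{n^2}\right)n^3=\frac{9nm-2n^3-2(n^2-3m)^{3/2}}{27}.$$ (iii) For every fixed $c\in(0,1/2)$, as $n\to\infty$, $$k_4(n,\lceil cn^2\rceil)=\varphi_4(c)\,n^4+o(n^4).$$ -/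

import Mathlib

noncomputable section

namespace CliqueDensity

/-- The number `k_r(G)` of `r`-cliques of `G`. -/
def cliqueCount {V : Type*} (G : SimpleGraph V) (r : ℕ) : ℕ :=
  (G.cliqueSet r).ncard

/-- The number of edges of `G`. -/
def edgeCount {V : Type*} (G : SimpleGraph V) : ℕ :=
  G.edgeSet.ncard

/-- `k_r(n, m)`: the minimum number of `r`-cliques in graphs with `n` vertices and `m` edges
(the set is nonempty exactly when `m ≤ n.choose 2`). -/
def minCliqueCount (r n m : ℕ) : ℕ :=
  sInf {k : ℕ | ∃ G : SimpleGraph (Fin n), edgeCount G = m ∧ cliqueCount G r = k}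

/-- The form `L_r(A, x) = ∑_{X ⊆ [n], |X| = r} (∏_{i, j ∈ X, i < j} a_{ij}) ∏_{i ∈ X} x_i`. -/
def form (r : ℕ) {n : ℕ} (A : Matrix (Fin n) (Fin n) ℝ) (x : Fin n → ℝ) : ℝ :=
  ∑ X ∈ Finset.powersetCard r (Finset.univ : Finset (Fin n)),
    (∏ p ∈ (X ×ˢ X).filter (fun p => p.1 < p.2), A p.1 p.2) * ∏ i ∈ X, x i

/-- `ξ(c) = ⌈1 / (1 - 2c)⌉`, for `0 < c < 1/2`. -/
def xi (c : ℝ) : ℕ := ⌈1 / (1 - 2 * c)⌉₊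

/-- The zero-diagonal matrix `A_s` with all off-diagonal entries equal to `1`. -/
def fullMatrix (s : ℕ) : Matrix (Fin s) (Fin s) ℝ :=
  Matrix.of fun i j => if i = j then 0 else 1

/-- The `s`-vector `x_c = (x, …, x, y)`, `s = ξ(c)`, where `x ≥ y` solve
`(s-1 choose 2) x² + (s-1) x y = c`, `(s-1) x + y = 1`. -/
def extremalVector (c : ℝ) : Fin (xi c) → ℝ := fun i =>
  let s : ℝ := (xi c : ℝ)
  if (i : ℕ) + 1 < xi c then
    1 / s + 1 / s * √(1 - 2 * s / (s - 1) * c)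
  else
    1 / s - (s - 1) / s * √(1 - 2 * s / (s - 1) * c)

/-- `φ_r(c) = L_r(A_s, x_c)` with `s = ξ(c)`, for `0 < c < 1/2`. -/
def phi (r : ℕ) (c : ℝ) : ℝ :=
  form r (fullMatrix (xi c)) (extremalVector c)

end CliqueDensity

end

/-!
The graph problem is a special case of a problem on weighted graphs: a symmetric `a` with entries in `[0, 1]`
and a probability vector `x`, for which `L_r` denotes the weighted number of `r`-cliques. Fix `p ≥ 2` and let
`L₂` vary between the Turán densities of `p - 1` and `p` parts. The conjectured minimum of `L_r` is attained by
complete `p`-partite graphs with parts `u, …, u, 1 - (p - 1) u`; as a function `Φ` of `L₂` it is concave on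
this interval, with slope `μ`. If the bound fails, compactness gives a minimum of `L_r - Φ(L₂)`, which is
interior because the bound is known at Turán densities (Goodman, Moon–Moser). At this minimum
(`exists_critical`) the link of every vertex `i` in the support satisfies `L_{r-1}(link i) = λ + μ d_i` with
the same slope `μ` as the extremal graph and a smaller constant `λ`, and the perturbation of edges gives
averaged upper bounds for the number of `(r - 2)`-cliques in common neighbourhoods.

For triangles the argument is an induction on `p`. With `e_ij` the codegrees, the product
`(μ - e_ij) (e_ij - (d_i + d_j - 1))` has nonnegative sum over the edges; inserted into inclusion–exclusion
over the triangles this bounds `L₄` from above by a linear expression in `L₂`, `L₃` and `λ`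
(`homSum_four_le_of_critical`). On the other hand `4 L₄` is the average number of triangles in the links. The
links have edge density at most that of `p - 1` parts, so the induction hypothesis and Goodman's bound bound
this number from below (`link_triangles_ge`). Both bounds agree for the extremal `λ`, and for smaller `λ` they
contradict each other (`triangleBound_succ`).

For `K₄` the number of triangles in each link is `λ + μ d_i`, which is smaller than in the extremal graph. By
the triangle bound the links then have fewer edges than in the extremal graph (`link_edges_lt`). Summing over
all links, `L₃` is below its minimum for the given `L₂`, a contradiction (`k4Bound_of_triangleBound`).

The asymptotic statement follows with the lower bound, the right continuity of `φ₄`, and blow-ups of the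
extremal vector from which edges are deleted.
-/

noncomputable section

namespace CliqueDensity

open Finset Filter Topology

/-! ### Ordered clique sums and their first variation -/

section Weighted

variable {ι : Type*}

/-- The link of `i`: the weights `a i j * x j` that `x` induces on the neighbourhood of `i`. -/
def link (a : ι → ι → ℝ) (x : ι → ℝ) (i : ι) : ι → ℝ := fun j => a i j * x j

/-- A weighted graph: a symmetric function with values in `[0, 1]`. The diagonal is arbitrary, since no
argument below needs it to vanish. -/
structure IsKernel (a : ι → ι → ℝ) : Prop where
  symm : ∀ i j, a i j = a j i
  nonneg : ∀ i j, 0 ≤ a i j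
  le_one : ∀ i j, a i j ≤ 1

lemma link_comm (a : ι → ι → ℝ) (x : ι → ℝ) (i j : ι) :
    link a (link a x i) j = link a (link a x j) i := by
  funext k; simp only [link]; ring

lemma link_nonneg {a : ι → ι → ℝ} (ha : IsKernel a) {x : ι → ℝ} (hx : ∀ i, 0 ≤ x i) (i j : ι) :
    0 ≤ link a x i j := mul_nonneg (ha.nonneg i j) (hx j)

variable [Fintype ι]

/-- The ordered clique sum `∑ x i₁ ⋯ x iᵣ ∏_{p < q} a iₚ i_q` over all `r`-tuples, by recursion through
links. When the diagonal of `a` is zero it is `r!` times `L_r(a, x)`. -/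
def homSum (a : ι → ι → ℝ) : ℕ → (ι → ℝ) → ℝ
  | 0, _ => 1
  | r + 1, x => ∑ i, x i * homSum a r (fun j => a i j * x j)

lemma homSum_succ (a : ι → ι → ℝ) (r : ℕ) (x : ι → ℝ) :
    homSum a (r + 1) x = ∑ i, x i * homSum a r (link a x i) := rfl

lemma homSum_one (a : ι → ι → ℝ) (x : ι → ℝ) : homSum a 1 x = ∑ i, x i := by
  simp [homSum]

lemma homSum_nonneg {a : ι → ι → ℝ} (ha : IsKernel a) (r : ℕ) {x : ι → ℝ} (hx : ∀ i, 0 ≤ x i) :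
    0 ≤ homSum a r x := by
  induction r generalizing x with
  | zero => simp [homSum]
  | succ r ih =>
    exact Finset.sum_nonneg fun i _ => mul_nonneg (hx i) (ih (link_nonneg ha hx i))

lemma homSum_smul (a : ι → ι → ℝ) (r : ℕ) (c : ℝ) (x : ι → ℝ) :
    homSum a r (fun i => c * x i) = c ^ r * homSum a r x := by
  induction r generalizing x with
  | zero => simp [homSum]
  | succ r ih =>
    simp only [homSum, Finset.mul_sum]
    refine Finset.sum_congr rfl fun i _ => ?_
    have : (fun j => a i j * (c * x j)) = fun j => c * (a i j * x j) := by funext j; ring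
    rw [this, ih]; ring

lemma continuous_homSum {Y : Type*} [TopologicalSpace Y] (r : ℕ) {f : Y → ι → ι → ℝ}
    {g : Y → ι → ℝ} (hf : ∀ i j, Continuous fun y => f y i j) (hg : ∀ i, Continuous fun y => g y i) :
    Continuous fun y => homSum (f y) r (g y) := by
  induction r generalizing g with
  | zero => exact continuous_const
  | succ r ih =>
    exact continuous_finsetSum _ fun i _ => (hg i).mul (ih fun j => (hf i j).mul (hg j))

/-- First variation of `homSum` when the weights `x` are perturbed with logarithmic derivative `g` and the
entries of `a` with logarithmic derivative `w`. The perturbation `X` may be nonlinear in `ε`, because the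
induction passes to the links, where the factors of `A` and `X` multiply. -/
lemma hasDerivAt_homSum {a : ι → ι → ℝ} (ha : IsKernel a) {w : ι → ι → ℝ}
    {A : ℝ → ι → ι → ℝ} (hA0 : ∀ i j, A 0 i j = a i j)
    (hA : ∀ i j, HasDerivAt (fun ε => A ε i j) (w i j * a i j) 0) (r : ℕ) :
    ∀ {x g : ι → ℝ} {X : ℝ → ι → ℝ} (_ : ∀ i, X 0 i = x i)
    (_ : ∀ i, HasDerivAt (fun ε => X ε i) (g i * x i) 0),
    HasDerivAt (fun ε => homSum (A ε) r (X ε))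
      (r * ∑ i, g i * x i * homSum a (r - 1) (link a x i) +
        (r.choose 2) * ∑ i, x i * ∑ j, w i j * a i j * x j *
          homSum a (r - 2) (link a (link a x i) j)) 0 := by
  induction r with
  | zero => intro x g X _ _; simpa [homSum] using hasDerivAt_const (0:ℝ) (1:ℝ)
  | succ r ih =>
    intro x g X hX0 hX
    have key : ∀ i, HasDerivAt (fun ε => X ε i * homSum (A ε) r (fun j => A ε i j * X ε j))
        (g i * x i * homSum a r (link a x i) + x i *
        (r * ∑ j, (w i j + g j) * link a x i j * homSum a (r - 1) (link a (link a x i) j) +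
        (r.choose 2) * ∑ j, link a x i j * ∑ k, w j k * a j k * link a x i k *
          homSum a (r - 2) (link a (link a (link a x i) j) k))) 0 := by
      intro i
      have h1 := ih (x := link a x i) (g := fun j => w i j + g j) (X := fun ε j => A ε i j * X ε j)
        (fun j => by simp [hA0, hX0, link]) (fun j => by
          refine ((hA i j).mul (hX j)).congr_deriv ?_
          rw [hA0, hX0]; simp only [link]; ring)
      refine ((hX i).mul h1).congr_deriv ?_
      have h3 : A 0 = a := by funext i j; exact hA0 i j
      simp only [h3, hX0]
      rfl
    have hsum : (fun ε => homSum (A ε) (r + 1) (X ε)) =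
        fun ε => ∑ i, X ε i * homSum (A ε) r (fun j => A ε i j * X ε j) := rfl
    rw [hsum]
    refine (HasDerivAt.fun_sum fun i _ => key i).congr_deriv ?_
    rcases r with _ | r
    · simp
    have e1 : ∑ i, x i * ∑ j, g j * link a x i j * homSum a r (link a (link a x i) j)
        = ∑ i, g i * x i * homSum a (r + 1) (link a x i) := by
      simp only [homSum_succ, Finset.mul_sum]
      rw [Finset.sum_comm]
      refine Finset.sum_congr rfl fun i _ => Finset.sum_congr rfl fun j _ => ?_
      rw [link_comm]; simp only [link, ha.symm j i]; ring
    have e2 : ∑ i, x i * ∑ j, w i j * link a x i j * homSum a r (link a (link a x i) j)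
        = ∑ i, x i * ∑ j, w i j * a i j * x j * homSum a r (link a (link a x i) j) := by
      refine Finset.sum_congr rfl fun i _ => congrArg _ (Finset.sum_congr rfl fun j _ => ?_)
      simp only [link]; ring
    have e3 : r ≠ 0 → ∑ i, x i * ∑ j, link a x i j * ∑ k, w j k * a j k * link a x i k *
          homSum a (r - 1) (link a (link a (link a x i) j) k)
        = ∑ i, x i * ∑ j, w i j * a i j * x j * homSum a r (link a (link a x i) j) := by
      intro hr
      obtain ⟨q, rfl⟩ := Nat.exists_eq_succ_of_ne_zero hr
      simp only [Nat.succ_eq_add_one, homSum_succ, Finset.mul_sum, Nat.add_sub_cancel]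
      rw [Finset.sum_comm]
      refine Finset.sum_congr rfl fun i _ => ?_
      rw [Finset.sum_comm]
      refine Finset.sum_congr rfl fun j _ => Finset.sum_congr rfl fun k _ => ?_
      rw [link_comm a x k i, link_comm a (link a x i) k j]
      simp only [link, ha.symm k i, ha.symm k j]; ring
    have hc : (((r + 1 + 1).choose 2 : ℕ) : ℝ) = (r + 1) + ((r + 1).choose 2 : ℕ) := by
      rw [Nat.choose_succ_succ' (r + 1) 1]; push_cast; simp
    simp only [Nat.add_sub_cancel, show r + 1 + 1 - 2 = r by omega,
      show r + 1 - 2 = r - 1 by omega]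
    rw [hc]
    have e4 : ∑ i, x i * (((r + 1 : ℕ) : ℝ) * ∑ j, (w i j + g j) * link a x i j *
          homSum a r (link a (link a x i) j))
        = (r + 1) * (∑ i, x i * ∑ j, w i j * a i j * x j * homSum a r (link a (link a x i) j)
          + ∑ i, g i * x i * homSum a (r + 1) (link a x i)) := by
      rw [← e1, ← e2, ← Finset.sum_add_distrib, Finset.mul_sum]
      refine Finset.sum_congr rfl fun i _ => ?_
      rw [← mul_add, ← Finset.sum_add_distrib]
      push_cast
      rw [mul_left_comm]
      congr 3
      funext j
      ring
    have e5 : ∑ i, x i * (((r + 1).choose 2 : ℕ) * ∑ j, link a x i j * ∑ k, w j k * a j k *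
          link a x i k * homSum a (r - 1) (link a (link a (link a x i) j) k))
        = ((r + 1).choose 2 : ℕ) * ∑ i, x i * ∑ j, w i j * a i j * x j *
          homSum a r (link a (link a x i) j) := by
      rcases eq_or_ne r 0 with rfl | hr
      · simp
      · rw [← e3 hr, Finset.mul_sum]
        refine Finset.sum_congr rfl fun i _ => ?_
        ring
    have e6 : ∀ i, g i * x i * homSum a (r + 1) (link a x i) + x i *
        (((r + 1 : ℕ) : ℝ) * ∑ j, (w i j + g j) * link a x i j *
          homSum a r (link a (link a x i) j) +
        ((r + 1).choose 2 : ℕ) * ∑ j, link a x i j * ∑ k, w j k * a j k * link a x i k *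
          homSum a (r - 1) (link a (link a (link a x i) j) k))
        = g i * x i * homSum a (r + 1) (link a x i) + x i * (((r + 1 : ℕ) : ℝ) *
          ∑ j, (w i j + g j) * link a x i j * homSum a r (link a (link a x i) j)) + x i *
          (((r + 1).choose 2 : ℕ) * ∑ j, link a x i j * ∑ k, w j k * a j k * link a x i k *
          homSum a (r - 1) (link a (link a (link a x i) j) k)) := fun i => by ring
    rw [Finset.sum_congr rfl fun i _ => e6 i, Finset.sum_add_distrib, Finset.sum_add_distrib,
      e4, e5]
    push_cast
    ring

/-! ### Inclusion–exclusion inequalities -/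

/-- The weighted codegree `∑ k, a j k * a i k * x k` of `i` and `j`. -/
def codeg (a : ι → ι → ℝ) (x : ι → ℝ) (i j : ι) : ℝ := homSum a 1 (link a (link a x i) j)

lemma codeg_symm (a : ι → ι → ℝ) (x : ι → ℝ) (i j : ι) : codeg a x i j = codeg a x j i := by
  rw [codeg, link_comm, codeg]

lemma homSum_two (a : ι → ι → ℝ) (x : ι → ℝ) :
    homSum a 2 x = ∑ i, x i * ∑ j, a i j * x j := by
  simp only [homSum_succ a 1, homSum_one, link]

lemma homSum_three (a : ι → ι → ℝ) (x : ι → ℝ) :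
    homSum a 3 x = ∑ i, x i * ∑ j, a i j * x j * codeg a x i j := rfl

lemma sum_edges_add {a : ι → ι → ℝ} (ha : IsKernel a) (x f : ι → ℝ) :
    ∑ i, x i * ∑ j, a i j * x j * (f i + f j) =
      2 * ∑ i, x i * f i * homSum a 1 (link a x i) := by
  have h1 : ∑ i, x i * ∑ j, a i j * x j * f i = ∑ i, x i * f i * homSum a 1 (link a x i) := by
    refine Finset.sum_congr rfl fun i _ => ?_
    rw [homSum_one, mul_assoc, mul_comm (f i), Finset.sum_mul]; rfl
  have h2 : ∑ i, x i * ∑ j, a i j * x j * f j = ∑ i, x i * ∑ j, a i j * x j * f i := by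
    simp only [Finset.mul_sum]
    rw [Finset.sum_comm]
    refine Finset.sum_congr rfl fun i _ => Finset.sum_congr rfl fun j _ => ?_
    rw [ha.symm]; ring
  simp only [mul_add, Finset.sum_add_distrib]
  rw [h2, h1]; ring

/-- Inclusion–exclusion for two neighbourhoods. It is an equality for complete multipartite graphs. -/
lemma degree_add_degree_le_codeg {a : ι → ι → ℝ} (ha : IsKernel a) {x : ι → ℝ}
    (hx : ∀ i, 0 ≤ x i) (h1 : ∑ i, x i = 1) (i j : ι) :
    homSum a 1 (link a x i) + homSum a 1 (link a x j) - 1 ≤ codeg a x i j := by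
  have : 0 ≤ ∑ k, x k * ((1 - a i k) * (1 - a j k)) := Finset.sum_nonneg fun k _ =>
    mul_nonneg (hx k) (mul_nonneg (by linarith [ha.le_one i k]) (by linarith [ha.le_one j k]))
  have h2 : ∑ k, x k * ((1 - a i k) * (1 - a j k)) = ∑ k, x k - ∑ k, a i k * x k
      - ∑ k, a j k * x k + ∑ k, a j k * (a i k * x k) := by
    simp only [← Finset.sum_sub_distrib, ← Finset.sum_add_distrib]
    exact Finset.sum_congr rfl fun k _ => by ring
  simp only [codeg, homSum_one, link]
  linarith

lemma le_homSum_three {a : ι → ι → ℝ} (ha : IsKernel a) {x : ι → ℝ}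
    (hx : ∀ i, 0 ≤ x i) (h1 : ∑ i, x i = 1) :
    2 * ∑ i, x i * homSum a 1 (link a x i) ^ 2 - homSum a 2 x ≤ homSum a 3 x := by
  have h := sum_edges_add ha x (fun i => homSum a 1 (link a x i))
  have h3 : ∑ i, x i * ∑ j, a i j * x j *
      (homSum a 1 (link a x i) + homSum a 1 (link a x j) - 1) ≤ homSum a 3 x := by
    rw [homSum_three]
    exact Finset.sum_le_sum fun i _ => mul_le_mul_of_nonneg_left (Finset.sum_le_sum fun j _ =>
      mul_le_mul_of_nonneg_left (degree_add_degree_le_codeg ha hx h1 i j)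
        (mul_nonneg (ha.nonneg i j) (hx j))) (hx i)
  simp only [mul_sub, mul_one, Finset.sum_sub_distrib, ← homSum_two] at h3
  simp only [h] at h3
  have : ∀ i, x i * homSum a 1 (link a x i) ^ 2 =
    x i * homSum a 1 (link a x i) * homSum a 1 (link a x i) := fun i => by ring
  simp only [this]
  exact h3

lemma sq_sum_mul_le {x f : ι → ℝ} (hx : ∀ i, 0 ≤ x i) (h1 : ∑ i, x i = 1) :
    (∑ i, x i * f i) ^ 2 ≤ ∑ i, x i * f i ^ 2 := by
  obtain ⟨m, hm⟩ : ∃ m, m = ∑ i, x i * f i := ⟨_, rfl⟩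
  have h := Finset.sum_nonneg (s := univ) fun i _ => mul_nonneg (hx i) (sq_nonneg (f i - m))
  have e : ∑ i, x i * (f i - m) ^ 2 = ∑ i, x i * f i ^ 2
      - 2 * m * ∑ i, x i * f i + m ^ 2 * ∑ i, x i := by
    rw [Finset.mul_sum, Finset.mul_sum, ← Finset.sum_sub_distrib, ← Finset.sum_add_distrib]
    exact Finset.sum_congr rfl fun k _ => by ring
  rw [e, h1, ← hm] at h
  rw [← hm]
  linarith

/-- Goodman's bound, in the form `3 L₃ ≥ 4 L₂² - L₂`. -/
lemma goodman {a : ι → ι → ℝ} (ha : IsKernel a) {x : ι → ℝ}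
    (hx : ∀ i, 0 ≤ x i) (h1 : ∑ i, x i = 1) :
    2 * homSum a 2 x ^ 2 - homSum a 2 x ≤ homSum a 3 x := by
  have h := le_homSum_three ha hx h1
  have h2 := sq_sum_mul_le (f := fun i => homSum a 1 (link a x i)) hx h1
  rw [← homSum_succ] at h2
  linarith

lemma sum_triangles_swap {a : ι → ι → ℝ} (ha : IsKernel a) (x : ι → ℝ) (F : ι → ι → ι → ℝ) :
    ∑ i, x i * ∑ j, link a x i j * ∑ k, link a (link a x i) j k * F j i k =
      ∑ i, x i * ∑ j, link a x i j * ∑ k, link a (link a x i) j k * F i j k := by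
  simp only [Finset.mul_sum]
  rw [Finset.sum_comm]
  refine Finset.sum_congr rfl fun i _ => Finset.sum_congr rfl fun j _ =>
    Finset.sum_congr rfl fun k _ => ?_
  simp only [link, ha.symm j i]; ring

lemma sum_triangles_swap' {a : ι → ι → ℝ} (ha : IsKernel a) (x : ι → ℝ) (F : ι → ι → ι → ℝ) :
    ∑ i, x i * ∑ j, link a x i j * ∑ k, link a (link a x i) j k * F i k j =
      ∑ i, x i * ∑ j, link a x i j * ∑ k, link a (link a x i) j k * F i j k := by
  refine Finset.sum_congr rfl fun i _ => congrArg _ ?_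
  simp only [Finset.mul_sum]
  rw [Finset.sum_comm]
  refine Finset.sum_congr rfl fun j _ => Finset.sum_congr rfl fun k _ => ?_
  simp only [link, ha.symm k j]; ring

lemma sum_triangles_mono {a : ι → ι → ℝ} (ha : IsKernel a) {x : ι → ℝ} (hx : ∀ i, 0 ≤ x i)
    {F G : ι → ι → ι → ℝ} (h : ∀ i j k, F i j k ≤ G i j k) :
    ∑ i, x i * ∑ j, link a x i j * ∑ k, link a (link a x i) j k * F i j k ≤
      ∑ i, x i * ∑ j, link a x i j * ∑ k, link a (link a x i) j k * G i j k :=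
  Finset.sum_le_sum fun i _ => mul_le_mul_of_nonneg_left (Finset.sum_le_sum fun j _ =>
    mul_le_mul_of_nonneg_left (Finset.sum_le_sum fun k _ => mul_le_mul_of_nonneg_left (h i j k)
      (link_nonneg ha (link_nonneg ha hx i) j k)) (link_nonneg ha hx i j)) (hx i)

lemma sum_triangles_degree {a : ι → ι → ℝ} (x f : ι → ℝ) :
    ∑ i, x i * ∑ j, link a x i j * ∑ k, link a (link a x i) j k * f i =
      ∑ i, x i * f i * homSum a 2 (link a x i) := by
  refine Finset.sum_congr rfl fun i _ => ?_
  simp only [← Finset.sum_mul, ← mul_assoc]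
  rw [homSum_two]; simp only [link]; ring

lemma sum_triangles_codeg {a : ι → ι → ℝ} (x : ι → ℝ) :
    ∑ i, x i * ∑ j, link a x i j * ∑ k, link a (link a x i) j k * codeg a x i j =
      ∑ i, x i * ∑ j, a i j * x j * codeg a x i j ^ 2 := by
  refine Finset.sum_congr rfl fun i _ => congrArg _ (Finset.sum_congr rfl fun j _ => ?_)
  rw [← Finset.sum_mul, ← homSum_one a (link a (link a x i) j), ← codeg, sq]; rfl

lemma homSum_four (a : ι → ι → ℝ) (x : ι → ℝ) :
    homSum a 4 x = ∑ i, x i * ∑ j, link a x i j * ∑ k, link a (link a x i) j k *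
      homSum a 1 (link a (link a (link a x i) j) k) := rfl

lemma homSum_three' (a : ι → ι → ℝ) (x : ι → ℝ) :
    homSum a 3 x = ∑ i, x i * ∑ j, link a x i j * ∑ k, link a (link a x i) j k * 1 := by
  simp only [homSum_succ a 2, homSum_succ a 1, homSum_one, mul_one]

/-- Inclusion–exclusion for the three neighbourhoods of the vertices of a triangle, summed over triangles. -/
lemma homSum_four_le {a : ι → ι → ℝ} (ha : IsKernel a) {x : ι → ℝ}
    (hx : ∀ i, 0 ≤ x i) (h1 : ∑ i, x i = 1) :
    homSum a 4 x ≤ homSum a 3 x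
      - 3 * ∑ i, x i * homSum a 1 (link a x i) * homSum a 2 (link a x i)
      + 3 * ∑ i, x i * ∑ j, a i j * x j * codeg a x i j ^ 2 := by
  set D := fun i => homSum a 1 (link a x i) with hD
  have key : ∀ i j k, homSum a 1 (link a (link a (link a x i) j) k) ≤
      1 - D i - D j - D k + codeg a x i j + codeg a x i k + codeg a x j k := by
    intro i j k
    have : 0 ≤ ∑ l, x l * ((1 - a i l) * (1 - a j l) * (1 - a k l)) :=
      Finset.sum_nonneg fun l _ => mul_nonneg (hx l) (mul_nonneg (mul_nonneg
        (by linarith [ha.le_one i l]) (by linarith [ha.le_one j l])) (by linarith [ha.le_one k l]))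
    have h2 : ∑ l, x l * ((1 - a i l) * (1 - a j l) * (1 - a k l)) = ∑ l, x l - ∑ l, a i l * x l
        - ∑ l, a j l * x l - ∑ l, a k l * x l + ∑ l, a j l * (a i l * x l)
        + ∑ l, a k l * (a i l * x l) + ∑ l, a k l * (a j l * x l)
        - ∑ l, a k l * (a j l * (a i l * x l)) := by
      simp only [← Finset.sum_sub_distrib, ← Finset.sum_add_distrib]
      exact Finset.sum_congr rfl fun k _ => by ring
    simp only [hD, codeg, homSum_one, link]
    linarith
  have h := sum_triangles_mono ha hx key
  rw [← homSum_four] at h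
  simp only [mul_add, mul_sub, Finset.sum_add_distrib, Finset.sum_sub_distrib] at h
  have d1 := sum_triangles_degree (a := a) x D
  have d2 := sum_triangles_swap ha x (fun i _ _ => D i)
  have d3 := sum_triangles_swap' ha x (fun _ j _ => D j)
  have c1 := sum_triangles_codeg (a := a) x
  have c2 := sum_triangles_swap' ha x (fun i j _ => codeg a x i j)
  have c3 := sum_triangles_swap ha x (fun i _ k => codeg a x i k)
  rw [← homSum_three'] at h
  linarith

/-- The Moon–Moser bound for `K₄`, linearised: `α` stands for the typical codegree of an edge. -/
lemma le_homSum_four {a : ι → ι → ℝ} (ha : IsKernel a) {x : ι → ℝ}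
    (hx : ∀ i, 0 ≤ x i) (h1 : ∑ i, x i = 1) (α : ℝ) :
    (6 * α - 1) * homSum a 3 x - 3 * α ^ 2 * homSum a 2 x ≤ 2 * homSum a 4 x := by
  have key : ∀ i j k, codeg a x i j + codeg a x i k + codeg a x j k - 1 ≤
      homSum a 1 (link a (link a (link a x i) j) k) * 2 := by
    intro i j k
    have : 0 ≤ ∑ l, x l * ((1 - a i l) * (1 - a j l) * (1 - a k l) +
        a i l * ((1 - a j l) * (1 - a k l)) + a j l * ((1 - a i l) * (1 - a k l)) +
        a k l * ((1 - a i l) * (1 - a j l))) :=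
      Finset.sum_nonneg fun l _ => by
        have i0 := ha.nonneg i l
        have j0 := ha.nonneg j l
        have k0 := ha.nonneg k l
        have i1 : 0 ≤ 1 - a i l := by linarith [ha.le_one i l]
        have j1 : 0 ≤ 1 - a j l := by linarith [ha.le_one j l]
        have k1 : 0 ≤ 1 - a k l := by linarith [ha.le_one k l]
        have := hx l
        positivity
    have h2 : ∑ l, x l * ((1 - a i l) * (1 - a j l) * (1 - a k l) +
        a i l * ((1 - a j l) * (1 - a k l)) + a j l * ((1 - a i l) * (1 - a k l)) +
        a k l * ((1 - a i l) * (1 - a j l))) = ∑ l, x l - ∑ l, a j l * (a i l * x l)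
        - ∑ l, a k l * (a i l * x l) - ∑ l, a k l * (a j l * x l)
        + 2 * ∑ l, a k l * (a j l * (a i l * x l)) := by
      rw [Finset.mul_sum]
      simp only [← Finset.sum_sub_distrib, ← Finset.sum_add_distrib]
      exact Finset.sum_congr rfl fun k _ => by ring
    simp only [codeg, homSum_one, link]
    linarith
  have h := sum_triangles_mono ha hx key
  have e : ∑ i, x i * ∑ j, link a x i j * ∑ k, link a (link a x i) j k *
      (homSum a 1 (link a (link a (link a x i) j) k) * 2) = 2 * homSum a 4 x := by
    rw [homSum_four]
    simp only [← mul_assoc, ← Finset.sum_mul]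
    rw [mul_comm]
  rw [e] at h
  simp only [mul_add, mul_sub, Finset.sum_add_distrib, Finset.sum_sub_distrib] at h
  have c1 := sum_triangles_codeg (a := a) x
  have c2 := sum_triangles_swap' ha x (fun i j _ => codeg a x i j)
  have c3 := sum_triangles_swap ha x (fun i _ k => codeg a x i k)
  rw [← homSum_three'] at h
  have hs : 2 * α * homSum a 3 x - α ^ 2 * homSum a 2 x ≤
      ∑ i, x i * ∑ j, a i j * x j * codeg a x i j ^ 2 := by
    rw [homSum_three, homSum_two]
    simp only [Finset.mul_sum, ← Finset.sum_sub_distrib]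
    refine Finset.sum_le_sum fun i _ => Finset.sum_le_sum fun j _ => ?_
    have := mul_nonneg (mul_nonneg (hx i) (mul_nonneg (ha.nonneg i j) (hx j)))
      (sq_nonneg (codeg a x i j - α))
    linarith
  linarith

/-! ### Minima and first-order conditions -/

/-- A probability vector. -/
structure IsWeight (x : ι → ℝ) : Prop where
  nonneg : ∀ i, 0 ≤ x i
  sum_eq_one : ∑ i, x i = 1

lemma IsWeight.le_one {x : ι → ℝ} (hx : IsWeight x) (i : ι) : x i ≤ 1 := by
  rw [← hx.sum_eq_one]
  exact Finset.single_le_sum (fun j _ => hx.nonneg j) (Finset.mem_univ i)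

/-- By compactness, `L_r - Φ(L₂)` has a minimum over weighted graphs with `L₂` in a given interval. -/
lemma exists_forall_defect_le {r : ℕ} {Φ : ℝ → ℝ} (hΦ : Continuous Φ) {α β : ℝ}
    {a₀ : ι → ι → ℝ} {x₀ : ι → ℝ} (ha₀ : IsKernel a₀) (hx₀ : IsWeight x₀)
    (h₀ : homSum a₀ 2 x₀ / 2 ∈ Set.Icc α β) :
    ∃ (a : ι → ι → ℝ) (x : ι → ℝ), IsKernel a ∧ IsWeight x ∧ homSum a 2 x / 2 ∈ Set.Icc α β ∧
      ∀ (b : ι → ι → ℝ) (y : ι → ℝ), IsKernel b → IsWeight y → homSum b 2 y / 2 ∈ Set.Icc α β →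
        homSum a r x / r.factorial - Φ (homSum a 2 x / 2) ≤
          homSum b r y / r.factorial - Φ (homSum b 2 y / 2) := by
  let K : Set ((ι → ι → ℝ) × (ι → ℝ)) :=
    {p | ∀ i j, p.1 i j = p.1 j i} ∩
      ({p | ∑ i, p.2 i = 1} ∩ {p | homSum p.1 2 p.2 / 2 ∈ Set.Icc α β}) ∩
      Set.Icc 0 1
  have hc : ∀ r, Continuous fun p : (ι → ι → ℝ) × (ι → ℝ) => homSum p.1 r p.2 := fun r =>
    continuous_homSum r (fun i j => by fun_prop) fun i => by fun_prop
  have hK : IsCompact K := by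
    refine isCompact_Icc.inter_left ?_
    refine IsClosed.inter ?_ (IsClosed.inter ?_ ?_)
    · simp only [Set.ofPred_forall]
      exact isClosed_iInter fun i => isClosed_iInter fun j =>
        isClosed_eq (by fun_prop) (by fun_prop)
    · exact isClosed_eq (by fun_prop) (by fun_prop)
    · exact isClosed_Icc.preimage ((hc 2).div_const 2)
  have hmem : ∀ (b : ι → ι → ℝ) (y : ι → ℝ), IsKernel b → IsWeight y → homSum b 2 y / 2 ∈ Set.Icc α β → (b, y) ∈ K :=
    fun b y hb hy h => ⟨⟨hb.symm, hy.sum_eq_one, h⟩, ⟨⟨hb.nonneg, hy.nonneg⟩,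
      ⟨hb.le_one, hy.le_one⟩⟩⟩
  obtain ⟨⟨a, x⟩, h, hmin⟩ := hK.exists_isMinOn ⟨_, hmem _ _ ha₀ hx₀ h₀⟩
    (f := fun p => homSum p.1 r p.2 / r.factorial - Φ (homSum p.1 2 p.2 / 2))
    (((hc r).div_const _).sub (hΦ.comp ((hc 2).div_const 2))).continuousOn
  refine ⟨a, x, ⟨h.1.1, fun i j => h.2.1.1 i j, fun i j => h.2.2.1 i j⟩,
    ⟨fun i => h.2.1.2 i, h.1.2.1⟩, h.1.2.2, fun b y hb hy hby => ?_⟩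
  exact hmin (hmem b y hb hy hby)

lemma deriv_nonneg_of_le {f : ℝ → ℝ} {f' : ℝ} (hf : HasDerivAt f f' 0)
    (h : ∀ᶠ ε in 𝓝[>] (0 : ℝ), f 0 ≤ f ε) : 0 ≤ f' := by
  have h1 := (hasDerivAt_iff_tendsto_slope.1 hf).mono_left
    (nhdsWithin_mono (0 : ℝ) (fun y (hy : y ∈ Set.Ioi (0 : ℝ)) => ne_of_gt hy))
  refine ge_of_tendsto h1 ?_
  filter_upwards [h, self_mem_nhdsWithin] with ε h2 h3
  rw [slope_def_field]
  exact div_nonneg (by linarith) (by simpa using le_of_lt h3)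

/-- Conditions at a minimum of `L_r - Φ(L₂)` with `L₂` interior, where `μ = Φ'(L₂)`. Perturbing `x` gives
`L_{r-1}(link i) = λ + μ d_i` on the support of `x`; lowering the entries of `a` in the direction `w`
gives the inequality. -/
lemma first_order_conditions {r : ℕ} (hr : 1 ≤ r) {Φ : ℝ → ℝ} {α β μ : ℝ}
    {a : ι → ι → ℝ} {x : ι → ℝ} (ha : IsKernel a) (hx : IsWeight x)
    (hc : homSum a 2 x / 2 ∈ Set.Ioo α β)
    (hμ : HasDerivAt Φ μ (homSum a 2 x / 2))
    (hmin : ∀ (b : ι → ι → ℝ) (y : ι → ℝ), IsKernel b → IsWeight y → homSum b 2 y / 2 ∈ Set.Icc α β →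
        homSum a r x / r.factorial - Φ (homSum a 2 x / 2) ≤
          homSum b r y / r.factorial - Φ (homSum b 2 y / 2)) :
    (∀ i, x i ≠ 0 → r / r.factorial * homSum a (r - 1) (link a x i) - μ * homSum a 1 (link a x i)
        = r / r.factorial * homSum a r x - μ * homSum a 2 x) ∧
    (∀ w : ι → ι → ℝ, (∀ i j, w i j = w j i) → (∀ i j, 0 ≤ w i j) →
      r.choose 2 / r.factorial * ∑ i, x i * ∑ j, w i j * a i j * x j *
          homSum a (r - 2) (link a (link a x i) j) ≤
        μ / 2 * ∑ i, x i * ∑ j, w i j * a i j * x j) := by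
  have main : ∀ (w : ι → ι → ℝ) (g : ι → ℝ), (∀ i j, w i j = w j i) → (∀ i j, 0 ≤ w i j) →
      ∑ i, g i * x i = 0 →
      0 ≤ (r * ∑ i, g i * x i * homSum a (r - 1) (link a x i) +
        (r.choose 2) * ∑ i, x i * ∑ j, -w i j * a i j * x j *
          homSum a (r - 2) (link a (link a x i) j)) / r.factorial -
        μ * ((2 * ∑ i, g i * x i * homSum a 1 (link a x i) +
          ∑ i, x i * ∑ j, -w i j * a i j * x j) / 2) := by
    intro w g hws hw hg
    -- multiplicative perturbations stay feasible for small `ε` and do not leave the support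
    let A : ℝ → ι → ι → ℝ := fun ε i j => (1 - ε * w i j) * a i j
    let X : ℝ → ι → ℝ := fun ε i => (1 + ε * g i) * x i
    have hA0 : ∀ i j, A 0 i j = a i j := fun i j => by simp [A]
    have hX0 : ∀ i, X 0 i = x i := fun i => by simp [X]
    have hA : ∀ i j, HasDerivAt (fun ε => A ε i j) (-w i j * a i j) 0 := fun i j => by
      have := (((hasDerivAt_id (0 : ℝ)).mul_const (w i j)).const_sub 1).mul_const (a i j)
      simpa [A] using this
    have hX : ∀ i, HasDerivAt (fun ε => X ε i) (g i * x i) 0 := fun i => by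
      have := (((hasDerivAt_id (0 : ℝ)).mul_const (g i)).const_add 1).mul_const (x i)
      simpa [X] using this
    have hr' := hasDerivAt_homSum ha hA0 hA r hX0 hX
    have h2' := hasDerivAt_homSum ha hA0 hA 2 hX0 hX
    have A0 : A 0 = a := by funext i j; exact hA0 i j
    have X0 : X 0 = x := by funext i; exact hX0 i
    have hd := (hr'.div_const (r.factorial : ℝ)).sub
      (HasDerivAt.comp (0 : ℝ) (h₂ := Φ) (h := fun ε => homSum (A ε) 2 (X ε) / 2)
        (by simpa only [A0, X0] using hμ) (h2'.div_const 2))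
    have key := deriv_nonneg_of_le hd ?_
    · simpa [homSum] using key
    have hc2 : Continuous fun ε => homSum (A ε) 2 (X ε) / 2 :=
      (continuous_homSum 2 (fun i j => by simp only [A]; fun_prop)
        (fun i => by simp only [X]; fun_prop)).div_const 2
    have e1 : ∀ᶠ ε in 𝓝[>] (0 : ℝ), homSum (A ε) 2 (X ε) / 2 ∈ Set.Ioo α β :=
      nhdsWithin_le_nhds (hc2.continuousAt.eventually_mem
        (isOpen_Ioo.mem_nhds (by simpa only [A0, X0] using hc)))
    have e2 : ∀ᶠ ε in 𝓝[>] (0 : ℝ), ∀ i j, 0 < 1 - ε * w i j := by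
      refine nhdsWithin_le_nhds (eventually_all.2 fun i => eventually_all.2 fun j => ?_)
      have : Continuous fun ε : ℝ => 1 - ε * w i j := by fun_prop
      exact this.continuousAt.eventually_mem (isOpen_Ioi.mem_nhds (by simp))
    have e3 : ∀ᶠ ε in 𝓝[>] (0 : ℝ), ∀ i, 0 < 1 + ε * g i := by
      refine nhdsWithin_le_nhds (eventually_all.2 fun i => ?_)
      have : Continuous fun ε : ℝ => 1 + ε * g i := by fun_prop
      exact this.continuousAt.eventually_mem (isOpen_Ioi.mem_nhds (by simp))
    filter_upwards [e1, e2, e3, self_mem_nhdsWithin] with ε h1 h2 h3 h4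
    have := hmin (A ε) (X ε) ⟨fun i j => by simp only [A, ha.symm i j, hws i j],
      fun i j => mul_nonneg (h2 i j).le (ha.nonneg i j), fun i j => ?_⟩
      ⟨fun i => mul_nonneg (h3 i).le (hx.nonneg i), ?_⟩ (Set.Ioo_subset_Icc_self h1)
    · simpa only [A0, X0, Pi.sub_apply, Function.comp_apply] using this
    · refine mul_le_one₀ ?_ (ha.nonneg i j) (ha.le_one i j)
      have : 0 ≤ ε * w i j := mul_nonneg (le_of_lt h4) (hw i j)
      linarith
    · simp only [X, add_mul, one_mul, Finset.sum_add_distrib, mul_assoc, ← Finset.mul_sum, hg,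
        hx.sum_eq_one]
      simp
  constructor
  · have hg : ∀ g : ι → ℝ, ∑ i, g i * x i = 0 →
        0 ≤ ∑ i, g i * x i * (r / r.factorial * homSum a (r - 1) (link a x i) -
          μ * homSum a 1 (link a x i)) := by
      intro g hg
      have h := main 0 g (fun _ _ => rfl) (fun _ _ => le_rfl) hg
      simp only [Pi.zero_apply, neg_zero, zero_mul, Finset.sum_const_zero, mul_zero, add_zero] at h
      have e : ∑ i, g i * x i * (r / r.factorial * homSum a (r - 1) (link a x i) -
          μ * homSum a 1 (link a x i)) = r / r.factorial *
          ∑ i, g i * x i * homSum a (r - 1) (link a x i) -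
          μ * ∑ i, g i * x i * homSum a 1 (link a x i) := by
        simp only [Finset.mul_sum, ← Finset.sum_sub_distrib]
        exact Finset.sum_congr rfl fun i _ => by ring
      rw [e]
      linarith [h, mul_div_right_comm (r : ℝ) (∑ i, g i * x i * homSum a (r - 1) (link a x i))
        (r.factorial : ℝ)]
    obtain ⟨q, rfl⟩ : ∃ q, r = q + 1 := ⟨r - 1, by omega⟩
    obtain ⟨v, hv⟩ : ∃ v : ι → ℝ, v = fun i => ((q + 1 : ℕ) : ℝ) / (q + 1).factorial *
      homSum a q (link a x i) - μ * homSum a 1 (link a x i) := ⟨_, rfl⟩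
    obtain ⟨m, hm⟩ : ∃ m : ℝ, m = ((q + 1 : ℕ) : ℝ) / (q + 1).factorial * homSum a (q + 1) x -
      μ * homSum a 2 x := ⟨_, rfl⟩
    have hvm : ∑ i, x i * v i = m := by
      rw [hm, homSum_succ a q, homSum_succ a 1, Finset.mul_sum, Finset.mul_sum,
        ← Finset.sum_sub_distrib, hv]
      exact Finset.sum_congr rfl fun i _ => by ring
    -- moving against the deviation from the mean shows that its variance vanishes
    have h := hg (fun i => -(v i - m)) (by
      have : ∀ i, -(v i - m) * x i = m * x i - x i * v i := fun i => by ring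
      simp only [this, Finset.sum_sub_distrib, ← Finset.mul_sum, hvm, hx.sum_eq_one]; ring)
    have e : ∑ i, -(v i - m) * x i * v i = - ∑ i, x i * (v i - m) ^ 2 := by
      have : ∀ i, -(v i - m) * x i * v i = -(x i * (v i - m) ^ 2) - m * (x i * v i) +
        m ^ 2 * x i := fun i => by ring
      simp only [this, Finset.sum_sub_distrib, Finset.sum_add_distrib, ← Finset.mul_sum, hvm,
        hx.sum_eq_one, Finset.sum_neg_distrib]; ring
    have h' : 0 ≤ ∑ i, -(v i - m) * x i * v i := by simpa only [hv, Nat.add_sub_cancel] using h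
    rw [e] at h'
    have h0 : ∑ i, x i * (v i - m) ^ 2 = 0 := le_antisymm (by linarith)
      (Finset.sum_nonneg fun i _ => mul_nonneg (hx.nonneg i) (sq_nonneg _))
    intro i hi
    have := (Finset.sum_eq_zero_iff_of_nonneg
      (fun i _ => mul_nonneg (hx.nonneg i) (sq_nonneg _))).1 h0 i (Finset.mem_univ i)
    have h3 : v i - m = 0 := by simpa [hi] using this
    rw [hv, hm] at h3
    simpa [sub_eq_zero] using h3
  · intro w hws hw
    have h := main w 0 hws hw (by simp)
    simp only [Pi.zero_apply, zero_mul, Finset.sum_const_zero, mul_zero, zero_add, neg_mul,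
      Finset.sum_neg_distrib, mul_neg] at h
    have := mul_div_right_comm (r.choose 2 : ℝ) (∑ i, x i * ∑ j, w i j * a i j * x j *
          homSum a (r - 2) (link a (link a x i) j)) (r.factorial : ℝ)
    rw [← this]
    rw [neg_div] at h
    linarith

/-! ### The extremal curve -/

/-- The value of `L₂` for the complete `p`-partite graph whose parts have weights `u, …, u, 1 - (p - 1) u`. -/
def edgeDens (p u : ℝ) : ℝ := (p - 1) * (u - p / 2 * u ^ 2)

/-- The value of `L₃` for the graph of `edgeDens`. -/
def triDens (p u : ℝ) : ℝ :=
  (p - 1) * (p - 2) / 2 * u ^ 2 - p * (p - 1) * (p - 2) / 3 * u ^ 3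

/-- The value of `L₄` for the graph of `edgeDens`. -/
def k4Dens (p u : ℝ) : ℝ :=
  (p - 1) * (p - 2) * (p - 3) / 6 * u ^ 3 - p * (p - 1) * (p - 2) * (p - 3) / 8 * u ^ 4

/-- The larger part size `u ≥ 1 / p` at which `edgeDens p u = c`. -/
def partSize (p c : ℝ) : ℝ := 1 / p + 1 / p * √(1 - 2 * p / (p - 1) * c)

lemma continuous_partSize (p : ℝ) : Continuous (partSize p) := by
  unfold partSize; fun_prop

lemma one_div_le_partSize {p : ℝ} (hp : 2 ≤ p) (c : ℝ) : 1 / p ≤ partSize p c := by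
  have : 0 ≤ 1 / p * √(1 - 2 * p / (p - 1) * c) := by positivity
  unfold partSize; linarith

lemma partSize_le {p c : ℝ} (hp : 2 ≤ p) (hc : (p - 2) / (2 * (p - 1)) ≤ c) :
    partSize p c ≤ 1 / (p - 1) := by
  have hp1 : 0 < p - 1 := by linarith
  have h : √(1 - 2 * p / (p - 1) * c) ≤ 1 / (p - 1) := by
    rw [Real.sqrt_le_left (by positivity)]
    have h1 : 2 * p / (p - 1) * ((p - 2) / (2 * (p - 1))) ≤ 2 * p / (p - 1) * c :=
      mul_le_mul_of_nonneg_left hc (by positivity)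
    have h2 : 1 - 2 * p / (p - 1) * ((p - 2) / (2 * (p - 1))) = (1 / (p - 1)) ^ 2 := by
      field_simp; ring
    linarith
  have h2 : 1 / p * √(1 - 2 * p / (p - 1) * c) ≤ 1 / p * (1 / (p - 1)) :=
    mul_le_mul_of_nonneg_left h (by positivity)
  have h3 : 1 / p + 1 / p * (1 / (p - 1)) = 1 / (p - 1) := by field_simp; ring
  unfold partSize; linarith

lemma discr_nonneg {p c : ℝ} (hp : 2 ≤ p) (hc : c ≤ (p - 1) / (2 * p)) :
    0 ≤ 1 - 2 * p / (p - 1) * c := by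
  have hp1 : 0 < p - 1 := by linarith
  have h1 : 2 * p / (p - 1) * c ≤ 2 * p / (p - 1) * ((p - 1) / (2 * p)) :=
      mul_le_mul_of_nonneg_left hc (by positivity)
  have h2 : 2 * p / (p - 1) * ((p - 1) / (2 * p)) = 1 := by field_simp
  linarith

lemma edgeDens_partSize {p c : ℝ} (hp : 2 ≤ p) (hc : c ≤ (p - 1) / (2 * p)) :
    edgeDens p (partSize p c) = c := by
  have hp1 : 0 < p - 1 := by linarith
  have h := Real.sq_sqrt (discr_nonneg hp hc)
  obtain ⟨t, ht⟩ : ∃ t, t = √(1 - 2 * p / (p - 1) * c) := ⟨_, rfl⟩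
  rw [← ht] at h
  unfold edgeDens partSize
  rw [← ht]
  have e : (p - 1) * (1 / p + 1 / p * t - p / 2 * (1 / p + 1 / p * t) ^ 2) =
    (p - 1) / (2 * p) * (1 - t ^ 2) := by field_simp; ring
  rw [e, h]; field_simp; ring

lemma hasDerivAt_partSize {p c : ℝ} (hp : 2 ≤ p) (hc : c < (p - 1) / (2 * p)) :
    p * partSize p c - 1 ≠ 0 ∧
    HasDerivAt (partSize p) (-1 / ((p - 1) * (p * partSize p c - 1))) c := by
  have hp1 : 0 < p - 1 := by linarith
  have hpos : 0 < 1 - 2 * p / (p - 1) * c := by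
    have h1 : 2 * p / (p - 1) * c < 2 * p / (p - 1) * ((p - 1) / (2 * p)) :=
      mul_lt_mul_of_pos_left hc (by positivity)
    have h2 : 2 * p / (p - 1) * ((p - 1) / (2 * p)) = 1 := by field_simp
    linarith
  have e : p * partSize p c - 1 = √(1 - 2 * p / (p - 1) * c) := by
    unfold partSize; field_simp; ring
  have hs := Real.sqrt_pos.2 hpos
  refine ⟨by rw [e]; exact hs.ne', ?_⟩
  have h1 : HasDerivAt (fun c : ℝ => 1 - 2 * p / (p - 1) * c) (-(2 * p / (p - 1))) c := by
    simpa using ((hasDerivAt_id c).const_mul (2 * p / (p - 1))).const_sub 1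
  have h2 := ((h1.sqrt hpos.ne').const_mul (1 / p)).const_add (1 / p)
  refine h2.congr_deriv ?_
  rw [e]; field_simp

/-- The slope is the codegree of an edge between a large part and the small one. -/
lemma hasDerivAt_triDens_partSize {p c : ℝ} (hp : 2 ≤ p) (hc : c < (p - 1) / (2 * p)) :
    HasDerivAt (fun c => triDens p (partSize p c)) ((p - 2) * partSize p c) c := by
  obtain ⟨h0, h⟩ := hasDerivAt_partSize hp hc
  have hp1 : 0 < p - 1 := by linarith
  have h2 := ((h.pow 2).const_mul ((p - 1) * (p - 2) / 2)).sub
    ((h.pow 3).const_mul (p * (p - 1) * (p - 2) / 3))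
  refine h2.congr_deriv ?_
  field_simp; push_cast; ring

/-- The slope is the edge weight in the common neighbourhood of an edge between a large part and the small
one. -/
lemma hasDerivAt_k4Dens_partSize {p c : ℝ} (hp : 2 ≤ p) (hc : c < (p - 1) / (2 * p)) :
    HasDerivAt (fun c => k4Dens p (partSize p c)) ((p - 2) * (p - 3) / 2 * partSize p c ^ 2) c := by
  obtain ⟨h0, h⟩ := hasDerivAt_partSize hp hc
  have hp1 : 0 < p - 1 := by linarith
  have h2 := ((h.pow 3).const_mul ((p - 1) * (p - 2) * (p - 3) / 6)).sub
    ((h.pow 4).const_mul (p * (p - 1) * (p - 2) * (p - 3) / 8))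
  refine h2.congr_deriv ?_
  field_simp; push_cast; ring

/-- Along the curve `(edgeDens q, triDens q)` on `u ≥ 1 / q` the triangle density is a concave function of the
edge density, with slope `(q - 2) u`; this is the tangent line inequality. -/
lemma triDens_sub_le {q v X : ℝ} (hq : 2 ≤ q) (hv : 1 / q ≤ v) (hX : 1 / q ≤ X) :
    triDens q v - triDens q X ≤ (q - 2) * X * (edgeDens q v - edgeDens q X) := by
  have h1 : 1 ≤ q * v := by rwa [div_le_iff₀' (by linarith)] at hv
  have h2 : 1 ≤ q * X := by rwa [div_le_iff₀' (by linarith)] at hX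
  have e : (q - 2) * X * (edgeDens q v - edgeDens q X) - (triDens q v - triDens q X) =
      (q - 1) * (q - 2) * (X - v) ^ 2 / 6 * (2 * (q * v - 1) + (q * X - 1)) := by
    unfold triDens edgeDens; ring
  have : 0 ≤ (q - 1) * (q - 2) * (X - v) ^ 2 / 6 * (2 * (q * v - 1) + (q * X - 1)) := by
    have a1 : 0 ≤ q - 1 := by linarith
    have a2 : 0 ≤ q - 2 := by linarith
    have a3 : 0 ≤ q * v - 1 := by linarith
    have a4 : 0 ≤ q * X - 1 := by linarith
    positivity
  linarith

/-- The edge density is largest at the balanced point `v = 1 / q`. -/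
lemma edgeDens_le (q v : ℝ) (hq : 2 ≤ q) : edgeDens q v ≤ (q - 1) / (2 * q) := by
  have e : (q - 1) / (2 * q) - edgeDens q v = (q - 1) / (2 * q) * (q * v - 1) ^ 2 := by
    unfold edgeDens; field_simp; ring
  have : 0 ≤ (q - 1) / (2 * q) * (q * v - 1) ^ 2 := by
    have : 0 ≤ q - 1 := by linarith
    positivity
  linarith

/-- The tangent line to Goodman's parabola at the Turán density `(q - 1) / (2 q)`, where Goodman's bound is
sharp. -/
lemma goodman_tangent {q cc C : ℝ} (hq : 2 ≤ q) (hG : 4 * cc ^ 2 - cc ≤ 3 * C) :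
    triDens q (1 / q) + (3 * q - 4) / (3 * q) * (cc - (q - 1) / (2 * q)) ≤ C := by
  have e : (4 * cc ^ 2 - cc) - 3 * (triDens q (1 / q) +
      (3 * q - 4) / (3 * q) * (cc - (q - 1) / (2 * q))) = 4 * (cc - (q - 1) / (2 * q)) ^ 2 := by
    unfold triDens; field_simp; ring
  nlinarith [sq_nonneg (cc - (q - 1) / (2 * q))]

lemma triDens_one_div_pred {q : ℝ} (hq : 3 ≤ q) : triDens q (1 / (q - 1)) =
    triDens (q - 1) (1 / (q - 1)) := by
  have : 0 < q - 1 := by linarith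
  unfold triDens; field_simp; ring

lemma edgeDens_one_div_pred {q : ℝ} (hq : 2 ≤ q) :
    edgeDens q (1 / (q - 1)) = (q - 2) / (2 * (q - 1)) := by
  have : 0 < q - 1 := by linarith
  unfold edgeDens; field_simp; ring

lemma edgeDens_one_div {q : ℝ} (hq : 2 ≤ q) :
    edgeDens q (1 / q) = (q - 1) / (2 * q) := by
  unfold edgeDens; field_simp; ring

/-- Below the Turán density of `q - 1` parts the slope of the tangent line may be enlarged to that of
`triDens q` at `1 / (q - 1)`. -/
lemma goodman_tangent_pred {q cc C : ℝ} (hq : 3 ≤ q) (hG : 4 * cc ^ 2 - cc ≤ 3 * C)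
    (hcc : cc ≤ (q - 2) / (2 * (q - 1))) :
    triDens q (1 / (q - 1)) + (q - 2) / (q - 1) * (cc - (q - 2) / (2 * (q - 1))) ≤ C := by
  have h := goodman_tangent (q := q - 1) (by linarith) hG
  rw [triDens_one_div_pred hq]
  have hq1 : 0 < q - 1 := by linarith
  have e : (q - 1 - 1) / (2 * (q - 1)) = (q - 2) / (2 * (q - 1)) := by ring
  rw [e] at h
  have h2 : (3 * (q - 1) - 4) / (3 * (q - 1)) ≤ (q - 2) / (q - 1) := by
    rw [div_le_div_iff₀ (by positivity) hq1]; nlinarith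
  have := mul_le_mul_of_nonpos_right h2 (sub_nonpos.2 hcc)
  linarith

/-- A link has edge density `cc`, triangle density `C`, and `v` is the size of a large part relative to the
weight of the link. Measured from the extremal point `v`, the triangle density drops by at most
`(q - 1) / q` times the drop of the edge density. For `v < 1 / q` the bound `cc ≤ (q - 1) v / 2`, which says
that degrees in the link are at most `(q - 1) v` on average, replaces the induction hypothesis. -/
lemma triDens_sub_le_of_le_edgeDens {q v cc C : ℝ} (hq : 3 ≤ q) (hG : 4 * cc ^ 2 - cc ≤ 3 * C)
    (hP : ∀ X, 1 / q ≤ X → X ≤ 1 / (q - 1) → cc = edgeDens q X → triDens q X ≤ C)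
    (hle : cc ≤ edgeDens q v)
    (hv : 1 / q ≤ v ∨ (cc ≤ (q - 1) * v / 2 ∧ 1 / (q + 1) ≤ v)) :
    triDens q v - (q - 1) / q * (edgeDens q v - cc) ≤ C := by
  have hq0 : 0 < q := by linarith
  have hq1 : 0 < q - 1 := by linarith
  have hκ : (q - 2) / (q - 1) ≤ (q - 1) / q := by
    rw [div_le_div_iff₀ hq1 hq0]; nlinarith
  by_cases hv1 : 1 / q ≤ v
  · by_cases hcc : (q - 2) / (2 * (q - 1)) ≤ cc
    · have hX := edgeDens_partSize (by linarith : 2 ≤ q) (hle.trans (edgeDens_le q v (by linarith)))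
      have hX1 := one_div_le_partSize (by linarith : 2 ≤ q) cc
      have hX2 := partSize_le (by linarith : 2 ≤ q) hcc
      have h1 := hP _ hX1 hX2 hX.symm
      have h2 := triDens_sub_le (by linarith : 2 ≤ q) hv1 hX1
      rw [hX] at h2
      have h3 : (q - 2) * partSize q cc ≤ (q - 1) / q := by
        refine le_trans ?_ hκ
        rw [div_eq_mul_one_div]
        exact mul_le_mul_of_nonneg_left hX2 (by linarith)
      have h4 := mul_le_mul_of_nonneg_right h3 (sub_nonneg.2 hle)
      linarith
    · push Not at hcc
      have h1 := goodman_tangent_pred hq hG hcc.le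
      have hX : 1 / q ≤ 1 / (q - 1) := one_div_le_one_div_of_le hq1 (by linarith)
      have h2 := triDens_sub_le (by linarith : 2 ≤ q) hv1 hX
      rw [edgeDens_one_div_pred (by linarith), mul_one_div] at h2
      have h4 := mul_le_mul_of_nonneg_right hκ (sub_nonneg.2 hle)
      linarith
  · have hv2 := hv.resolve_left hv1
    push Not at hv1
    have h1 := goodman_tangent (by linarith : 2 ≤ q) hG
    obtain ⟨w, hw⟩ : ∃ w, w = 1 / q - v := ⟨_, rfl⟩
    have hw0 : 0 < w := by rw [hw]; linarith
    have hv : v = 1 / q - w := by linarith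
    have hqw : w ≤ 1 / (q * (q + 1)) := by
      have : 1 / q - 1 / (q + 1) = 1 / (q * (q + 1)) := by field_simp; ring
      linarith [hv2.2]
    have hqw' : q * w * (q + 1) ≤ 1 := by
      rw [le_div_iff₀ (by positivity)] at hqw; linarith
    have e1 : triDens q (1 / q) - triDens q v = (q - 1) * (q - 2) * (w ^ 2 / 2 - q * w ^ 3 / 3) := by
      rw [hv]; unfold triDens; field_simp; ring
    have e2 : (q - 1) / (2 * q) - edgeDens q v = (q - 1) * q / 2 * w ^ 2 := by
      rw [hv]; unfold edgeDens; field_simp; ring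
    have e3 : edgeDens q v - (q - 1) * v / 2 = (q - 1) / 2 * (1 - q * w) * w := by
      rw [hv]; unfold edgeDens; field_simp; ring
    have hE : (q - 1) / 2 * (1 - q * w) * w ≤ edgeDens q v - cc := by linarith [hv2.1]
    obtain ⟨E, hE'⟩ : ∃ E, E = edgeDens q v - cc := ⟨_, rfl⟩
    -- the excess of the slope `(q - 1) / q` over Goodman's slope pays for the error of order `w ^ 2`
    have e4 : (q - 1) / q - (3 * q - 4) / (3 * q) = 1 / (3 * q) := by field_simp; ring
    have e5 : (3 * q - 4) / (3 * q) * ((q - 1) * q / 2 * w ^ 2) =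
      (q - 1) * (3 * q - 4) / 6 * w ^ 2 := by field_simp; ring
    have hfin : (q - 1) * w ^ 2 * (1 + q * (q - 2) * w) / 3 ≤ 1 / (3 * q) * E := by
      have h6 : (q - 1) * w * ((1 - q * w) / (2 * q)) ≤ 1 / q * E := by
        rw [hE', div_mul_eq_mul_div, one_mul, le_div_iff₀ hq0]
        refine le_trans (le_of_eq ?_) hE
        field_simp
      have h7 : w * (1 + q * (q - 2) * w) ≤ (1 - q * w) / (2 * q) := by
        rw [le_div_iff₀ (by positivity)]
        nlinarith [mul_nonneg hw0.le hw0.le, mul_nonneg hw0.le (sub_nonneg.2 hqw'),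
          mul_nonneg (mul_nonneg hw0.le hq0.le) (sub_nonneg.2 hq)]
      have h8 := mul_le_mul_of_nonneg_left h7 (mul_nonneg hq1.le hw0.le)
      have h9 : 1 / (3 * q) * E = 1 / q * E / 3 := by field_simp
      rw [h9]; linarith
    have hcc : cc - (q - 1) / (2 * q) = -E - (q - 1) * q / 2 * w ^ 2 := by rw [hE']; linarith
    rw [hcc] at h1
    rw [← hE']
    have e6 : (q - 1) / q * E = (3 * q - 4) / (3 * q) * E + 1 / (3 * q) * E := by
      rw [← e4]; ring
    linarith

/-- A link with fewer triangles than the extremal point `v` has fewer edges too. For `v < 1 / q` the curve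
turns back, and the extra bound on `C` excludes the second branch. -/
lemma lt_edgeDens_of_lt_triDens {q v cc C : ℝ} (hq : 3 ≤ q) (hG : 4 * cc ^ 2 - cc ≤ 3 * C)
    (hP : ∀ X, 1 / q ≤ X → X ≤ 1 / (q - 1) → cc = edgeDens q X → triDens q X ≤ C)
    (hlt : C < triDens q v)
    (hv : 1 / q ≤ v ∨ (C ≤ (q - 1) * (q - 2) / 6 * v ^ 2 ∧ 1 / (q + 1) ≤ v)) :
    cc < edgeDens q v := by
  have hq0 : 0 < q := by linarith
  have hq1 : 0 < q - 1 := by linarith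
  by_contra! hle
  by_cases hv1 : 1 / q ≤ v
  · by_cases hcq : (q - 1) / (2 * q) ≤ cc
    · have h1 := goodman_tangent (by linarith : 2 ≤ q) hG
      have h2 := triDens_sub_le (by linarith : 2 ≤ q) hv1 le_rfl
      rw [edgeDens_one_div (by linarith)] at h2
      have h3 : (q - 2) * (1 / q) * (edgeDens q v - (q - 1) / (2 * q)) ≤ 0 :=
        mul_nonpos_of_nonneg_of_nonpos (mul_nonneg (by linarith) (by positivity))
          (sub_nonpos.2 (edgeDens_le q v (by linarith)))
      have h4 : 0 ≤ (3 * q - 4) / (3 * q) * (cc - (q - 1) / (2 * q)) :=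
        mul_nonneg (div_nonneg (by linarith) (by linarith)) (by linarith)
      linarith
    by_cases hcc : (q - 2) / (2 * (q - 1)) ≤ cc
    · have hX := edgeDens_partSize (by linarith : 2 ≤ q) (not_le.1 hcq).le
      have hX1 := one_div_le_partSize (by linarith : 2 ≤ q) cc
      have hX2 := partSize_le (by linarith : 2 ≤ q) hcc
      have h1 := hP _ hX1 hX2 hX.symm
      have h2 := triDens_sub_le (by linarith : 2 ≤ q) hv1 hX1
      rw [hX] at h2
      have h3 : 0 ≤ (q - 2) * partSize q cc :=
        mul_nonneg (by linarith) (le_trans (by positivity) hX1)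
      have h4 := mul_nonneg h3 (sub_nonneg.2 hle)
      linarith
    · push Not at hcc
      have h1 := goodman_tangent_pred hq hG hcc.le
      have hX : 1 / q ≤ 1 / (q - 1) := one_div_le_one_div_of_le hq1 (by linarith)
      have h2 := triDens_sub_le (by linarith : 2 ≤ q) hv1 hX
      rw [edgeDens_one_div_pred (by linarith), mul_one_div] at h2
      have h4 := mul_nonneg (div_nonneg (by linarith : 0 ≤ q - 2) hq1.le) (sub_nonneg.2 hle)
      linarith
  · have hv2 := hv.resolve_left hv1
    push Not at hv1
    obtain ⟨ω, hω⟩ : ∃ ω, ω = 1 - q * v := ⟨_, rfl⟩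
    have hv : v = (1 - ω) / q := by rw [hω]; field_simp; ring
    have hω0 : 0 < ω := by
      rw [lt_div_iff₀ hq0] at hv1; rw [hω]; linarith
    have hω1 : ω * (q + 1) ≤ 1 := by
      have := hv2.2
      rw [div_le_iff₀ (by linarith)] at this; rw [hω]; nlinarith
    have hω2 : ω ≤ 1 / 4 := by nlinarith
    have hωq : (q - 1) * (ω * (1 + ω)) < q - 2 := by
      nlinarith [mul_nonneg hω0.le (sub_nonneg.2 hω1)]
    obtain ⟨τ, hτ⟩ : ∃ τ, τ = edgeDens q v := ⟨_, rfl⟩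
    rw [← hτ] at hle
    have e1 : τ = (q - 1) * (1 - ω ^ 2) / (2 * q) := by
      rw [hτ, hv]; unfold edgeDens; field_simp; ring
    have hpos : 0 ≤ q - 2 - 2 * (q - 1) * ω ^ 2 := by nlinarith
    have e2 : 4 * τ - 1 = (q - 2 - 2 * (q - 1) * ω ^ 2) / q := by rw [e1]; field_simp; ring
    have h4 : 0 ≤ 4 * τ - 1 := by rw [e2]; positivity
    have h5 : 4 * τ ^ 2 - τ ≤ 4 * cc ^ 2 - cc := by nlinarith
    have h6 : (q - 1) * (q - 2) / 2 * v ^ 2 < 4 * τ ^ 2 - τ := by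
      have e3 : 4 * τ ^ 2 - τ = (q - 1) * (1 - ω) / (2 * q ^ 2) *
        ((1 + ω) * (q - 2 - 2 * (q - 1) * ω ^ 2)) := by
        have : 4 * τ ^ 2 - τ = τ * (4 * τ - 1) := by ring
        rw [this, e2, e1]; field_simp; ring
      have e4 : (q - 1) * (q - 2) / 2 * v ^ 2 = (q - 1) * (1 - ω) / (2 * q ^ 2) *
        ((q - 2) * (1 - ω)) := by rw [hv]; field_simp
      rw [e3, e4]
      refine mul_lt_mul_of_pos_left ?_ (div_pos (mul_pos hq1 (by linarith)) (by positivity))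
      nlinarith [mul_pos hω0 (sub_pos.2 hωq)]
    linarith [hv2.1]

/-! ### The density theorems for weighted graphs -/

/-- The edge condition for the perturbation that lowers all edges at `i` by the same factor. -/
lemma link_homSum_le {r : ℕ} (hr : 2 ≤ r) {μ : ℝ} {a : ι → ι → ℝ} {x : ι → ℝ} (ha : IsKernel a)
    (h : ∀ w : ι → ι → ℝ, (∀ i j, w i j = w j i) → (∀ i j, 0 ≤ w i j) →
      r.choose 2 / r.factorial * ∑ i, x i * ∑ j, w i j * a i j * x j *
          homSum a (r - 2) (link a (link a x i) j) ≤
        μ / 2 * ∑ i, x i * ∑ j, w i j * a i j * x j) {i : ι} (hi : 0 < x i) :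
    r.choose 2 / r.factorial * homSum a (r - 1) (link a x i) ≤
      μ / 2 * homSum a 1 (link a x i) := by
  classical
  obtain ⟨q, rfl⟩ : ∃ q, r = q + 2 := ⟨r - 2, by omega⟩
  -- both orientations are lowered, which doubles every term
  have h1 := h (fun j k => (if j = i then 1 else 0) + (if k = i then 1 else 0))
    (fun j k => add_comm _ _) (fun j k => by positivity)
  have gen : ∀ F : ι → ι → ℝ, (∀ j k, F j k = F k j) → ∑ j, x j * ∑ k,
      ((if j = i then 1 else 0) + (if k = i then 1 else 0)) * a j k * x k * F j k =
      2 * (x i * ∑ k, link a x i k * F i k) := by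
    intro F hF
    simp only [add_mul, Finset.sum_add_distrib, mul_add, ite_mul, one_mul, zero_mul,
      Finset.sum_ite_eq', Finset.mem_univ, if_true]
    have : ∀ j, ∑ k, (if j = i then a j k * x k * F j k else 0) =
      if j = i then ∑ k, a j k * x k * F j k else 0 := fun j => by split_ifs <;> simp
    simp only [this, mul_ite, mul_zero, Finset.sum_ite_eq', Finset.mem_univ, if_true]
    have e : ∑ j, x j * (a j i * x i * F j i) = x i * ∑ k, link a x i k * F i k := by
      rw [Finset.mul_sum]
      refine Finset.sum_congr rfl fun j _ => ?_
      rw [ha.symm, hF]; simp only [link]; ring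
    rw [e]; simp only [link]; ring
  have g1 := gen (fun j k => homSum a q (link a (link a x j) k)) (fun j k => by rw [link_comm])
  have g2 := gen (fun _ _ => 1) (fun _ _ => rfl)
  simp only [mul_one] at g2
  rw [Nat.add_sub_cancel, g1, g2, ← homSum_succ, ← homSum_one a (link a x i)] at h1
  have h2 : x i * (((q + 2).choose 2 : ℕ) / ((q + 2).factorial : ℕ) * homSum a (q + 1) (link a x i)) ≤
    x i * (μ / 2 * homSum a 1 (link a x i)) := by linarith
  exact le_of_mul_le_mul_left h2 hi

/-- The sharp triangle bound for weighted graphs on `ι` whose edge density lies between the Turán densities of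
`p - 1` and `p` parts. -/
def TriangleBound (ι : Type*) [Fintype ι] (p : ℝ) : Prop :=
  ∀ (a : ι → ι → ℝ) (x : ι → ℝ) (u : ℝ), IsKernel a → IsWeight x → 1 / p ≤ u → u ≤ 1 / (p - 1) →
    homSum a 2 x / 2 = edgeDens p u → triDens p u ≤ homSum a 3 x / 6

lemma IsWeight.goodman {a : ι → ι → ℝ} (ha : IsKernel a) {x : ι → ℝ} (hx : IsWeight x) :
    4 * (homSum a 2 x / 2) ^ 2 - homSum a 2 x / 2 ≤ 3 * (homSum a 3 x / 6) := by
  have := CliqueDensity.goodman ha hx.nonneg hx.sum_eq_one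
  linarith

/-- A nonzero weight vector is a multiple of a probability vector, and clique sums scale accordingly. -/
lemma exists_isWeight_smul {y : ι → ℝ} (hy : ∀ i, 0 ≤ y i) (hd : 0 < ∑ i, y i) :
    ∃ z : ι → ℝ, IsWeight z ∧ ∀ (a : ι → ι → ℝ) (r : ℕ),
      homSum a r y = (∑ i, y i) ^ r * homSum a r z := by
  refine ⟨fun i => (∑ i, y i)⁻¹ * y i, ⟨fun i => mul_nonneg (inv_nonneg.2 hd.le) (hy i), ?_⟩,
    fun a r => ?_⟩
  · rw [← Finset.mul_sum, inv_mul_cancel₀ hd.ne']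
  · rw [← homSum_smul]
    congr 1
    funext i
    rw [mul_inv_cancel_left₀ hd.ne']

lemma degree_le_one {a : ι → ι → ℝ} (ha : IsKernel a) {x : ι → ℝ} (hx : IsWeight x) (i : ι) :
    homSum a 1 (link a x i) ≤ 1 := by
  rw [homSum_one, ← hx.sum_eq_one]
  exact Finset.sum_le_sum fun j _ => mul_le_of_le_one_left (hx.nonneg j) (ha.le_one i j)

/-- If the link of `i` has `δ` fewer edges than in the extremal graph with large parts of weight `u`, then its
triangle count is at most `(q - 1) / q * d_i * δ` below that of the extremal graph. -/
lemma link_triangles_ge {q u μ : ℝ} (hq : 3 ≤ q) (hP : TriangleBound ι q) {a : ι → ι → ℝ}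
    (ha : IsKernel a) {x : ι → ℝ} (hx : IsWeight x) (i : ι) (hu : 1 / (q + 1) ≤ u)
    (hμ : μ = (q - 1) * u)
    (ht : homSum a 2 (link a x i) ≤ μ * homSum a 1 (link a x i))
    {δ : ℝ} (hδ : 0 ≤ δ)
    (hδ' : homSum a 2 (link a x i) / 2 =
      (q - 1) * (u * homSum a 1 (link a x i) - q / 2 * u ^ 2) - δ) :
    (q - 1) * (q - 2) / 2 * u ^ 2 * homSum a 1 (link a x i) - q * (q - 1) * (q - 2) / 3 * u ^ 3 -
      (q - 1) / q * (homSum a 1 (link a x i) * δ) ≤ homSum a 3 (link a x i) / 6 := by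
  have hu0 : 0 < u := lt_of_lt_of_le (by positivity) hu
  have hy := link_nonneg ha hx.nonneg i
  have hd1 := degree_le_one ha hx i
  obtain ⟨d, hd⟩ : ∃ d, d = homSum a 1 (link a x i) := ⟨_, rfl⟩
  rw [← hd] at ht hδ' hd1 ⊢
  have hd0 : 0 ≤ d := by rw [hd]; exact homSum_nonneg ha 1 hy
  rcases hd0.eq_or_lt with h0 | hpos
  · rw [← h0]
    have h3 : 0 ≤ homSum a 3 (link a x i) := homSum_nonneg ha 3 hy
    have : 0 ≤ q * (q - 1) * (q - 2) / 3 * u ^ 3 := by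
      have : 0 ≤ q - 1 := by linarith
      have : 0 ≤ q - 2 := by linarith
      positivity
    simp only [mul_zero, zero_mul]
    linarith
  obtain ⟨z, hz, hzs⟩ := exists_isWeight_smul hy (by rw [← homSum_one a, ← hd]; exact hpos)
  rw [← homSum_one a, ← hd] at hzs
  have h2 := hzs a 2
  have h3 := hzs a 3
  have hv : u ≤ u / d := by rw [le_div_iff₀ hpos]; nlinarith
  have e1 : d ^ 2 * edgeDens q (u / d) = (q - 1) * (u * d - q / 2 * u ^ 2) := by
    unfold edgeDens; field_simp
  have e2 : d ^ 3 * triDens q (u / d) = (q - 1) * (q - 2) / 2 * u ^ 2 * d -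
      q * (q - 1) * (q - 2) / 3 * u ^ 3 := by
    unfold triDens; field_simp
  have hd2 : 0 < d ^ 2 := by positivity
  have hδe : d ^ 2 * (edgeDens q (u / d) - homSum a 2 z / 2) = δ := by
    rw [mul_sub, e1]; linarith
  have key := triDens_sub_le_of_le_edgeDens (v := u / d) hq (IsWeight.goodman ha hz)
    (fun X h1 h2 h3 => hP a z X ha hz h1 h2 h3)
    (by
      have : 0 ≤ d ^ 2 * (edgeDens q (u / d) - homSum a 2 z / 2) := by rw [hδe]; exact hδ
      linarith [nonneg_of_mul_nonneg_right this hd2])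
    (by
      right
      refine ⟨?_, hu.trans hv⟩
      have : d ^ 2 * (homSum a 2 z / 2) ≤ d ^ 2 * ((q - 1) * (u / d) / 2) := by
        have : d ^ 2 * ((q - 1) * (u / d) / 2) = μ * d / 2 := by rw [hμ]; field_simp
        linarith
      exact le_of_mul_le_mul_left this hd2)
  have key2 := mul_le_mul_of_nonneg_left key (by positivity : 0 ≤ d ^ 3)
  have e3 : d ^ 3 * (triDens q (u / d) - (q - 1) / q * (edgeDens q (u / d) - homSum a 2 z / 2)) =
    d ^ 3 * triDens q (u / d) - (q - 1) / q * (d * (d ^ 2 *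
      (edgeDens q (u / d) - homSum a 2 z / 2))) := by ring
  rw [e3, e2, hδe] at key2
  linarith

/-- If the link of `i` has fewer triangles than in the extremal graph with large parts of weight `u`, then it
has fewer edges. -/
lemma link_edges_lt {q u : ℝ} (hq : 3 ≤ q) (hP : TriangleBound ι q) {a : ι → ι → ℝ}
    (ha : IsKernel a) {x : ι → ℝ} (hx : IsWeight x) (i : ι) (hu : 1 / (q + 1) ≤ u)
    (hT : homSum a 3 (link a x i) / 6 ≤
      (q - 1) * (q - 2) / 6 * u ^ 2 * homSum a 1 (link a x i))
    (hT' : homSum a 3 (link a x i) / 6 < (q - 1) * (q - 2) / 2 * u ^ 2 * homSum a 1 (link a x i) -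
      q * (q - 1) * (q - 2) / 3 * u ^ 3) :
    homSum a 2 (link a x i) / 2 < (q - 1) * (u * homSum a 1 (link a x i) - q / 2 * u ^ 2) := by
  have hu0 : 0 < u := lt_of_lt_of_le (by positivity) hu
  have hy := link_nonneg ha hx.nonneg i
  have hd1 := degree_le_one ha hx i
  obtain ⟨d, hd⟩ : ∃ d, d = homSum a 1 (link a x i) := ⟨_, rfl⟩
  rw [← hd] at hT hT' hd1 ⊢
  have hd0 : 0 ≤ d := by rw [hd]; exact homSum_nonneg ha 1 hy
  rcases hd0.eq_or_lt with h0 | hpos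
  · exfalso
    rw [← h0] at hT'
    have h3 : 0 ≤ homSum a 3 (link a x i) := homSum_nonneg ha 3 hy
    have : 0 ≤ q * (q - 1) * (q - 2) / 3 * u ^ 3 := by
      have : 0 ≤ q - 1 := by linarith
      have : 0 ≤ q - 2 := by linarith
      positivity
    simp only [mul_zero] at hT'
    linarith
  obtain ⟨z, hz, hzs⟩ := exists_isWeight_smul hy (by rw [← homSum_one a, ← hd]; exact hpos)
  rw [← homSum_one a, ← hd] at hzs
  have h2 := hzs a 2
  have h3 := hzs a 3
  have hv : u ≤ u / d := by rw [le_div_iff₀ hpos]; nlinarith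
  have e1 : d ^ 2 * edgeDens q (u / d) = (q - 1) * (u * d - q / 2 * u ^ 2) := by
    unfold edgeDens; field_simp
  have e2 : d ^ 3 * triDens q (u / d) = (q - 1) * (q - 2) / 2 * u ^ 2 * d -
      q * (q - 1) * (q - 2) / 3 * u ^ 3 := by
    unfold triDens; field_simp
  have hd2 : 0 < d ^ 2 := by positivity
  have hd3 : 0 < d ^ 3 := by positivity
  have key := lt_edgeDens_of_lt_triDens (v := u / d) hq (IsWeight.goodman ha hz)
    (fun X h1 h2 h3 => hP a z X ha hz h1 h2 h3)
    (by
      refine lt_of_mul_lt_mul_left ?_ hd3.le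
      rw [e2]; linarith)
    (by
      right
      refine ⟨?_, hu.trans hv⟩
      refine le_of_mul_le_mul_left ?_ hd3
      have : d ^ 3 * ((q - 1) * (q - 2) / 6 * (u / d) ^ 2) =
        (q - 1) * (q - 2) / 6 * u ^ 2 * d := by field_simp
      rw [this]; linarith)
  have key2 := mul_lt_mul_of_pos_left key hd2
  rw [e1] at key2
  linarith

/-- At a critical point for triangles `(μ - e_ij) (e_ij - (d_i + d_j - 1))` has nonnegative sum over the edges.
In `homSum_four_le` this bounds the squares of codegrees, and the sums of `d_i ^ 2` cancel. -/
lemma homSum_four_le_of_critical {μ lam : ℝ} {a : ι → ι → ℝ} {x : ι → ℝ} (ha : IsKernel a)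
    (hx : IsWeight x)
    (h1 : ∀ i, x i ≠ 0 → homSum a 2 (link a x i) = 2 * lam + 2 * μ * homSum a 1 (link a x i))
    (h2 : ∀ w : ι → ι → ℝ, (∀ i j, w i j = w j i) → (∀ i j, 0 ≤ w i j) →
      ∑ i, x i * ∑ j, w i j * a i j * x j * codeg a x i j ≤
        μ * ∑ i, x i * ∑ j, w i j * a i j * x j) :
    homSum a 4 x ≤ (3 * μ - 2) * homSum a 3 x + 6 * lam * homSum a 2 x + 3 * μ * homSum a 2 x := by
  have h4 := homSum_four_le ha hx.nonneg hx.sum_eq_one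
  have hw := h2 (fun i j => codeg a x i j - (homSum a 1 (link a x i) + homSum a 1 (link a x j) - 1))
    (fun i j => by rw [codeg_symm]; ring)
    (fun i j => sub_nonneg.2 (degree_add_degree_le_codeg ha hx.nonneg hx.sum_eq_one i j))
  obtain ⟨D, hD⟩ : ∃ D : ι → ℝ, D = fun i => homSum a 1 (link a x i) := ⟨_, rfl⟩
  have hDi : ∀ i, homSum a 1 (link a x i) = D i := fun i => by rw [hD]
  simp only [hDi] at hw h4 h1
  have d1 : ∑ i, x i * ∑ j, a i j * x j * codeg a x i j * D i =
      ∑ i, x i * D i * homSum a 2 (link a x i) := by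
    refine Finset.sum_congr rfl fun i _ => ?_
    rw [← Finset.sum_mul, homSum_succ a 1]
    simp only [codeg, link]; ring
  have d2 : ∑ i, x i * ∑ j, a i j * x j * codeg a x i j * D j =
      ∑ i, x i * ∑ j, a i j * x j * codeg a x i j * D i := by
    simp only [Finset.mul_sum]
    rw [Finset.sum_comm]
    refine Finset.sum_congr rfl fun i _ => Finset.sum_congr rfl fun j _ => ?_
    rw [ha.symm, codeg_symm]; ring
  have e1 : ∑ i, x i * ∑ j, (codeg a x i j - (D i + D j - 1)) * a i j * x j * codeg a x i j =
      ∑ i, x i * ∑ j, a i j * x j * codeg a x i j ^ 2 -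
      2 * ∑ i, x i * D i * homSum a 2 (link a x i) + homSum a 3 x := by
    have : ∀ i j, (codeg a x i j - (D i + D j - 1)) * a i j * x j * codeg a x i j =
      a i j * x j * codeg a x i j ^ 2 - a i j * x j * codeg a x i j * D i -
        a i j * x j * codeg a x i j * D j + a i j * x j * codeg a x i j := fun i j => by ring
    simp only [this, Finset.sum_add_distrib, Finset.sum_sub_distrib, mul_add, mul_sub]
    rw [d2, d1, homSum_three]; ring
  have e2 : ∑ i, x i * ∑ j, (codeg a x i j - (D i + D j - 1)) * a i j * x j =
      homSum a 3 x - 2 * ∑ i, x i * D i * D i + homSum a 2 x := by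
    have : ∀ i j, (codeg a x i j - (D i + D j - 1)) * a i j * x j =
      a i j * x j * codeg a x i j - a i j * x j * (D i + D j) + a i j * x j := fun i j => by ring
    simp only [this, Finset.sum_add_distrib, Finset.sum_sub_distrib, mul_add, mul_sub]
    have h := sum_edges_add ha x D
    simp only [hDi, mul_add, Finset.sum_add_distrib] at h
    rw [homSum_three, homSum_two, ← h]
  have e3 : ∑ i, x i * D i * homSum a 2 (link a x i) =
      2 * lam * homSum a 2 x + 2 * μ * ∑ i, x i * D i * D i := by
    rw [homSum_succ a 1 x, Finset.mul_sum, Finset.mul_sum, ← Finset.sum_add_distrib]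
    refine Finset.sum_congr rfl fun i _ => ?_
    by_cases hi : x i = 0
    · simp [hi]
    · rw [h1 i hi, hDi]; ring
  rw [e1, e2] at hw
  rw [e3] at hw h4
  linarith

lemma triangleBound_two : TriangleBound ι 2 := by
  intro a x u ha hx _ _ _
  have := homSum_nonneg ha 3 hx.nonneg
  unfold triDens; linarith

/-- If the bound `L_r ≥ ψ(u)` fails somewhere between two consecutive Turán densities but holds at both, then
it fails at a weighted graph of intermediate density that satisfies the first-order conditions. -/
lemma exists_critical {r : ℕ} (hr : 1 ≤ r) {p : ℝ} (hp : 2 ≤ p) {ψ ψ' : ℝ → ℝ} (hψ : Continuous ψ)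
    (hψ' : ∀ c < (p - 1) / (2 * p), HasDerivAt (fun c => ψ (partSize p c)) (ψ' (partSize p c)) c)
    (hend : ∀ (a : ι → ι → ℝ) (x : ι → ℝ), IsKernel a → IsWeight x →
      (homSum a 2 x / 2 = (p - 2) / (2 * (p - 1)) → ψ (1 / (p - 1)) ≤ homSum a r x / r.factorial) ∧
      (homSum a 2 x / 2 = (p - 1) / (2 * p) → ψ (1 / p) ≤ homSum a r x / r.factorial))
    {a₀ : ι → ι → ℝ} {x₀ : ι → ℝ} {u₀ : ℝ} (ha₀ : IsKernel a₀) (hx₀ : IsWeight x₀)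
    (hu₀ : 1 / p ≤ u₀) (hu₀' : u₀ ≤ 1 / (p - 1)) (hc₀ : homSum a₀ 2 x₀ / 2 = edgeDens p u₀)
    (h₀ : homSum a₀ r x₀ / r.factorial < ψ u₀) :
    ∃ (a : ι → ι → ℝ) (x : ι → ℝ) (u : ℝ), IsKernel a ∧ IsWeight x ∧ 1 / p ≤ u ∧ u ≤ 1 / (p - 1) ∧
      homSum a 2 x / 2 = edgeDens p u ∧ (p - 2) / (2 * (p - 1)) < homSum a 2 x / 2 ∧
      homSum a r x / r.factorial < ψ u ∧
      (∀ i, x i ≠ 0 → r / r.factorial * homSum a (r - 1) (link a x i)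
        - ψ' u * homSum a 1 (link a x i)
          = r / r.factorial * homSum a r x - ψ' u * homSum a 2 x) ∧
      (∀ w : ι → ι → ℝ, (∀ i j, w i j = w j i) → (∀ i j, 0 ≤ w i j) →
        r.choose 2 / r.factorial * ∑ i, x i * ∑ j, w i j * a i j * x j *
            homSum a (r - 2) (link a (link a x i) j) ≤
          ψ' u / 2 * ∑ i, x i * ∑ j, w i j * a i j * x j) := by
  have hp0 : 0 < p := by linarith
  have hp1 : 0 < p - 1 := by linarith
  have part_edge : ∀ u, 1 / p ≤ u → partSize p (edgeDens p u) = u := by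
    intro u hu
    have h1 : 0 ≤ p * u - 1 := by rw [div_le_iff₀' hp0] at hu; linarith
    have : 1 - 2 * p / (p - 1) * edgeDens p u = (p * u - 1) ^ 2 := by
      unfold edgeDens; field_simp; ring
    unfold partSize
    rw [this, Real.sqrt_sq h1]; field_simp; ring
  have hmono : (p - 2) / (2 * (p - 1)) ≤ edgeDens p u₀ := by
    have : edgeDens p u₀ - (p - 2) / (2 * (p - 1)) =
      (1 / (p - 1) - u₀) * ((p - 1) * p / 2) * ((u₀ - 1 / p) + (1 / (p - 1) - 1 / p)) := by
      unfold edgeDens; field_simp; ring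
    have h2 : 0 ≤ (1 / (p - 1) - u₀) * ((p - 1) * p / 2) *
        ((u₀ - 1 / p) + (1 / (p - 1) - 1 / p)) := by
      have := sub_nonneg.2 hu₀
      have := sub_nonneg.2 hu₀'
      have : 0 ≤ 1 / (p - 1) - 1 / p := by linarith
      positivity
    linarith
  obtain ⟨a, x, ha, hx, hc, hmin⟩ := exists_forall_defect_le (r := r)
    (Φ := fun c => ψ (partSize p c)) (hψ.comp (continuous_partSize p))
    (α := (p - 2) / (2 * (p - 1))) (β := (p - 1) / (2 * p)) ha₀ hx₀
    ⟨by rw [hc₀]; exact hmono, by rw [hc₀]; exact edgeDens_le p u₀ hp⟩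
  have hneg : homSum a r x / r.factorial < ψ (partSize p (homSum a 2 x / 2)) := by
    have := hmin a₀ x₀ ha₀ hx₀
      ⟨by rw [hc₀]; exact hmono, by rw [hc₀]; exact edgeDens_le p u₀ hp⟩
    simp only [hc₀, part_edge u₀ hu₀] at this
    linarith
  have hα : (p - 2) / (2 * (p - 1)) < homSum a 2 x / 2 := by
    refine lt_of_le_of_ne hc.1 fun h => ?_
    have h1 := (hend a x ha hx).1 h.symm
    rw [← h, ← edgeDens_one_div_pred hp,
      part_edge _ (one_div_le_one_div_of_le hp1 (by linarith))] at hneg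
    linarith
  have hβ : homSum a 2 x / 2 < (p - 1) / (2 * p) := by
    refine lt_of_le_of_ne hc.2 fun h => ?_
    have h1 := (hend a x ha hx).2 h
    rw [h, ← edgeDens_one_div hp, part_edge _ le_rfl] at hneg
    linarith
  obtain ⟨f1, f2⟩ := first_order_conditions hr ha hx ⟨hα, hβ⟩ (hψ' _ hβ) hmin
  exact ⟨a, x, partSize p (homSum a 2 x / 2), ha, hx, one_div_le_partSize hp _,
    partSize_le hp hc.1, (edgeDens_partSize hp hc.2).symm, hα, hneg, f1, f2⟩

/-- The induction step. At a critical counterexample the upper bound for `K₄` decreases with the deficit `δ`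
of the Lagrange constant faster than the lower bound obtained from the links. -/
lemma triangleBound_succ {p : ℝ} (hp : 3 ≤ p) (hp' : p = 3 ∨ 4 ≤ p)
    (hP : TriangleBound ι (p - 1)) : TriangleBound ι p := by
  intro a₀ x₀ u₀ ha₀ hx₀ hu₀ hu₀' hc₀
  by_contra! h₀
  have hp0 : 0 < p := by linarith
  have hp1 : 0 < p - 1 := by linarith
  obtain ⟨a, x, u, ha, hx, hu, hu', hc, hα, hlt, f1, f2⟩ := exists_critical (r := 3) (by norm_num)
    (by linarith : 2 ≤ p) (ψ := triDens p) (ψ' := fun u => (p - 2) * u)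
    (by unfold triDens; fun_prop) (fun c hc => hasDerivAt_triDens_partSize (by linarith) hc)
    (fun a x ha hx => by
      have hG := hx.goodman ha
      have hf : ((Nat.factorial 3 : ℕ) : ℝ) = 6 := by norm_num [Nat.factorial]
      rw [hf]
      constructor
      · intro h
        have := goodman_tangent_pred hp hG h.le
        rw [h] at this; linarith
      · intro h
        have := goodman_tangent (by linarith : 2 ≤ p) hG
        rw [h] at this; linarith)
    ha₀ hx₀ hu₀ hu₀' hc₀ (by simpa [Nat.factorial] using h₀)
  have f3 := fun i hi => link_homSum_le (r := 3) (by norm_num) ha f2 (i := i) hi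
  norm_num [Nat.factorial, Nat.choose] at f1 f2 f3 hlt
  obtain ⟨μ, hμ⟩ : ∃ μ, μ = (p - 2) * u := ⟨_, rfl⟩
  obtain ⟨lam, hlam⟩ : ∃ lam, lam = 1 / 2 * homSum a 3 x - μ * homSum a 2 x := ⟨_, rfl⟩
  rw [← hμ] at f1 f2 f3
  have hS2 : homSum a 2 x = 2 * edgeDens p u := by linarith
  have hup := homSum_four_le_of_critical (lam := lam) (μ := μ) ha hx
    (fun i hi => by have := f1 i hi; rw [hlam]; linarith)
    (fun w h1 h2 => by
      have := f2 w h1 h2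
      have e : ∑ i, x i * ∑ j, w i j * a i j * x j * codeg a x i j =
        ∑ i, x i * ∑ j, w i j * a i j * x j * homSum a 1 (link a (link a x i) j) := rfl
      rw [e]; linarith)
  -- `δ` compares the Lagrange constant with that of the extremal graph
  obtain ⟨δ, hδ⟩ : ∃ δ, δ = -((p - 2) * (p - 1) / 2 * u ^ 2) - lam := ⟨_, rfl⟩
  have hδ0 : 0 < δ := by
    have : -((p - 2) * (p - 1) / 2 * u ^ 2) = 3 * triDens p u - μ * (2 * edgeDens p u) := by
      rw [hμ]; unfold triDens edgeDens; ring
    rw [hδ, hlam, this, hS2]; linarith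
  have hlam' : lam = -((p - 2) * (p - 1) / 2 * u ^ 2) - δ := by linarith
  have hS3 : homSum a 3 x = 2 * lam + 2 * μ * homSum a 2 x := by linarith
  have hup_eq : (3 * μ - 2) * homSum a 3 x + 6 * lam * homSum a 2 x + 3 * μ * homSum a 2 x =
      6 * ((p - 2) * (p - 3) / 2 * u ^ 2 * homSum a 2 x - (p - 1) * (p - 2) * (p - 3) / 3 * u ^ 3) -
      δ * (6 * μ + 6 * homSum a 2 x - 4) := by
    rw [hS3, hlam', hS2, hμ]; unfold edgeDens; ring
  have hu0 : 0 < u := lt_of_lt_of_le (by positivity) hu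
  have hpu : 1 ≤ p * u := by rwa [div_le_iff₀' hp0] at hu
  rw [hup_eq] at hup
  have h2c : (p - 2) / (p - 1) < homSum a 2 x := by
    have : (p - 2) / (2 * (p - 1)) = (p - 2) / (p - 1) / 2 := by field_simp
    linarith
  -- three parts: the links may be triangle-free, so `0 ≤ homSum a 4 x` is all that is available
  rcases hp' with rfl | hp4
  · have h4 := homSum_nonneg ha 4 hx.nonneg
    norm_num at hup h2c hμ
    have : 0 < δ * (6 * μ + 6 * homSum a 2 x - 4) := mul_pos hδ0 (by linarith)
    linarith
  · have hlow : ∀ i, x i * (6 * ((p - 2) * (p - 3) / 2 * u ^ 2 * homSum a 1 (link a x i) -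
        (p - 1) * (p - 2) * (p - 3) / 3 * u ^ 3 -
        (p - 2) / (p - 1) * (homSum a 1 (link a x i) * δ))) ≤ x i * homSum a 3 (link a x i) := by
      intro i
      rcases (hx.nonneg i).eq_or_lt with h0 | hi
      · simp [← h0]
      · refine mul_le_mul_of_nonneg_left ?_ hi.le
        have := link_triangles_ge (q := p - 1) (u := u) (μ := μ) (δ := δ) (by linarith) hP ha hx i
          (by rw [sub_add_cancel]; exact hu) (by rw [hμ]; ring) (by linarith [f3 i hi]) hδ0.le
          (by
            have : μ * homSum a 1 (link a x i) = (p - 2) * u * homSum a 1 (link a x i) := by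
              rw [hμ]
            rw [hδ]; linarith [f1 i hi.ne'])
        rw [show p - 1 - 1 = p - 2 by ring, show p - 1 - 2 = p - 3 by ring] at this
        linarith
    have hlow2 := Finset.sum_le_sum (s := univ) fun i _ => hlow i
    rw [← homSum_succ] at hlow2
    have e : ∑ i, x i * (6 * ((p - 2) * (p - 3) / 2 * u ^ 2 * homSum a 1 (link a x i) -
        (p - 1) * (p - 2) * (p - 3) / 3 * u ^ 3 -
        (p - 2) / (p - 1) * (homSum a 1 (link a x i) * δ))) =
        6 * ((p - 2) * (p - 3) / 2 * u ^ 2 * homSum a 2 x -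
          (p - 1) * (p - 2) * (p - 3) / 3 * u ^ 3) - 6 * ((p - 2) / (p - 1) * δ) * homSum a 2 x := by
      have : ∀ i, x i * (6 * ((p - 2) * (p - 3) / 2 * u ^ 2 * homSum a 1 (link a x i) -
        (p - 1) * (p - 2) * (p - 3) / 3 * u ^ 3 -
        (p - 2) / (p - 1) * (homSum a 1 (link a x i) * δ))) =
        (6 * ((p - 2) * (p - 3) / 2 * u ^ 2) - 6 * ((p - 2) / (p - 1) * δ)) *
          (x i * homSum a 1 (link a x i)) - 6 * ((p - 1) * (p - 2) * (p - 3) / 3 * u ^ 3) * x i :=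
        fun i => by ring
      simp only [this, Finset.sum_sub_distrib, ← Finset.mul_sum, hx.sum_eq_one, ← homSum_succ]
      ring
    rw [e] at hlow2
    have hfin : 0 < 6 * μ + 6 * homSum a 2 x - 4 - 6 * ((p - 2) / (p - 1)) * homSum a 2 x := by
      have e1 : 6 * μ + 6 * homSum a 2 x - 4 - 6 * ((p - 2) / (p - 1)) * homSum a 2 x =
        6 * μ - 4 + 6 * (homSum a 2 x / (p - 1)) := by field_simp; ring
      have h3 : (p - 2) / (p - 1) / (p - 1) < homSum a 2 x / (p - 1) :=
        div_lt_div_of_pos_right h2c hp1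
      have h4 : (p - 2) / p ≤ μ := by
        rw [hμ, div_eq_mul_one_div]
        exact mul_le_mul_of_nonneg_left hu (by linarith)
      have h5 : 0 < 6 * ((p - 2) / p) - 4 + 6 * ((p - 2) / (p - 1) / (p - 1)) := by
        have : 6 * ((p - 2) / p) - 4 + 6 * ((p - 2) / (p - 1) / (p - 1)) =
          2 * ((p - 2) ^ 3 + (p - 2) ^ 2 - (p - 2) - 4) / (p * (p - 1) ^ 2) := by
          field_simp; ring
        rw [this]
        have : 0 < (p - 2) ^ 3 + (p - 2) ^ 2 - (p - 2) - 4 := by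
          nlinarith [mul_nonneg (sub_nonneg.2 hp4) (sub_nonneg.2 hp4), sq_nonneg (p - 2)]
        positivity
      rw [e1]; linarith
    have := mul_pos hδ0 hfin
    linarith

/-- The triangle density theorem for weighted graphs. -/
theorem triangleBound (p : ℕ) (hp : 2 ≤ p) : TriangleBound ι p := by
  induction p, hp using Nat.le_induction with
  | base => exact_mod_cast triangleBound_two
  | succ p hp ih =>
    refine triangleBound_succ (by push_cast; have : (2 : ℝ) ≤ p := by exact_mod_cast hp
                                  linarith) ?_ (by simpa using ih)
    rcases hp.eq_or_lt with rfl | h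
    · left; norm_num
    · right
      have : (3 : ℝ) ≤ p := by exact_mod_cast h
      push_cast; linarith

/-- The `K₄` bound at Turán densities. -/
lemma k4Dens_le_of_turan {p : ℝ} (hp : 4 ≤ p) {a : ι → ι → ℝ} {x : ι → ℝ} (ha : IsKernel a)
    (hx : IsWeight x) (hc : homSum a 2 x / 2 = (p - 1) / (2 * p)) :
    k4Dens p (1 / p) ≤ homSum a 4 x / 24 := by
  have hp0 : 0 < p := by linarith
  have h1 := le_homSum_four ha hx.nonneg hx.sum_eq_one ((p - 2) / p)
  have h2 := goodman_tangent (by linarith : 2 ≤ p) (hx.goodman ha)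
  rw [hc] at h2
  have hS2 : homSum a 2 x = (p - 1) / p := by
    have : (p - 1) / (2 * p) = (p - 1) / p / 2 := by field_simp
    linarith
  have h3 : 0 ≤ 6 * ((p - 2) / p) - 1 := by
    have : 6 * ((p - 2) / p) - 1 = (5 * p - 12) / p := by field_simp; ring
    rw [this]; exact div_nonneg (by linarith) hp0.le
  have h4 : triDens p (1 / p) * 6 ≤ homSum a 3 x := by linarith
  have h5 := mul_le_mul_of_nonneg_left h4 h3
  have e : (6 * ((p - 2) / p) - 1) * (triDens p (1 / p) * 6) - 3 * ((p - 2) / p) ^ 2 *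
    ((p - 1) / p) = 2 * (24 * k4Dens p (1 / p)) := by
    unfold triDens k4Dens; field_simp; ring
  rw [hS2] at h1
  linarith

/-- At a critical counterexample for `K₄` every link has fewer triangles than in the extremal graph, hence
fewer edges; summing over the links contradicts the triangle bound. -/
lemma k4Bound_of_triangleBound {p : ℝ} (hp4 : p = 4 ∨ 5 ≤ p) (hB : TriangleBound ι p)
    (hP : TriangleBound ι (p - 1)) {a₀ : ι → ι → ℝ} {x₀ : ι → ℝ} {u₀ : ℝ} (ha₀ : IsKernel a₀)
    (hx₀ : IsWeight x₀) (hu₀ : 1 / p ≤ u₀) (hu₀' : u₀ ≤ 1 / (p - 1))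
    (hc₀ : homSum a₀ 2 x₀ / 2 = edgeDens p u₀) : k4Dens p u₀ ≤ homSum a₀ 4 x₀ / 24 := by
  have hp4l : 4 ≤ p := by rcases hp4 with h | h <;> linarith
  by_contra! h₀
  have hp0 : 0 < p := by linarith
  have hp1 : 0 < p - 1 := by linarith
  have hf : ((Nat.factorial 4 : ℕ) : ℝ) = 24 := by norm_num [Nat.factorial]
  obtain ⟨a, x, u, ha, hx, hu, hu', hc, hα, hlt, f1, f2⟩ := exists_critical (r := 4) (by norm_num)
    (by linarith : 2 ≤ p) (ψ := k4Dens p) (ψ' := fun u => (p - 2) * (p - 3) / 2 * u ^ 2)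
    (by unfold k4Dens; fun_prop) (fun c hc => hasDerivAt_k4Dens_partSize (by linarith) hc)
    (fun a x ha hx => by
      rw [hf]
      refine ⟨fun h => ?_, fun h => k4Dens_le_of_turan hp4l ha hx h⟩
      have e1 : k4Dens p (1 / (p - 1)) = k4Dens (p - 1) (1 / (p - 1)) := by
        unfold k4Dens; field_simp; ring
      by_cases h5 : 4 ≤ p - 1
      · rw [e1]
        refine k4Dens_le_of_turan h5 ha hx ?_
        rw [h]; ring
      · have hp4' : p = 4 := hp4.resolve_right fun h => h5 (by linarith)
        have h0 : k4Dens p (1 / (p - 1)) = 0 := by rw [hp4']; unfold k4Dens; norm_num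
        rw [h0]
        exact div_nonneg (homSum_nonneg ha 4 hx.nonneg) (by norm_num))
    ha₀ hx₀ hu₀ hu₀' hc₀ (by rw [hf]; exact h₀)
  have f3 := fun i hi => link_homSum_le (r := 4) (by norm_num) ha f2 (i := i) hi
  norm_num [Nat.factorial, Nat.choose] at f1 f3 hlt
  have hS2 : homSum a 2 x = 2 * edgeDens p u := by linarith
  have hlow : ∀ i, x i ≠ 0 → homSum a 2 (link a x i) / 2 <
      (p - 2) * (u * homSum a 1 (link a x i) - (p - 1) / 2 * u ^ 2) := by
    intro i hi
    have hi' : 0 < x i := lt_of_le_of_ne (hx.nonneg i) (Ne.symm hi)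
    have := link_edges_lt (q := p - 1) (u := u) (by linarith) hP ha hx i
      (by rw [sub_add_cancel]; exact hu) (by linarith [f3 i hi'])
      (by
        have e : -((p - 1) * (p - 2) * (p - 3) / 3 * u ^ 3) =
          4 * k4Dens p u - (p - 2) * (p - 3) / 2 * u ^ 2 * (2 * edgeDens p u) := by
          unfold k4Dens edgeDens; ring
        have := f1 i hi
        rw [hS2] at this
        rw [show p - 1 - 1 = p - 2 by ring, show p - 1 - 2 = p - 3 by ring]
        linarith)
    rwa [show p - 1 - 1 = p - 2 by ring] at this
  have hne : ∃ i, x i ≠ 0 := by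
    by_contra! h
    have := hx.sum_eq_one
    simp [h] at this
  obtain ⟨i₀, hi₀⟩ := hne
  have hsum : ∑ i, x i * (homSum a 2 (link a x i) / 2) <
      ∑ i, x i * ((p - 2) * (u * homSum a 1 (link a x i) - (p - 1) / 2 * u ^ 2)) := by
    refine Finset.sum_lt_sum (fun i _ => ?_) ⟨i₀, Finset.mem_univ _, ?_⟩
    · by_cases hi : x i = 0
      · simp [hi]
      · exact mul_le_mul_of_nonneg_left (hlow i hi).le (hx.nonneg i)
    · exact mul_lt_mul_of_pos_left (hlow i₀ hi₀) (lt_of_le_of_ne (hx.nonneg i₀) (Ne.symm hi₀))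
  have e1 : ∑ i, x i * (homSum a 2 (link a x i) / 2) = homSum a 3 x / 2 := by
    rw [homSum_succ a 2, Finset.sum_div]
    exact Finset.sum_congr rfl fun i _ => by ring
  have e2 : ∑ i, x i * ((p - 2) * (u * homSum a 1 (link a x i) - (p - 1) / 2 * u ^ 2)) =
      (p - 2) * u * homSum a 2 x - (p - 2) * (p - 1) / 2 * u ^ 2 := by
    have : ∀ i, x i * ((p - 2) * (u * homSum a 1 (link a x i) - (p - 1) / 2 * u ^ 2)) =
      (p - 2) * u * (x i * homSum a 1 (link a x i)) - (p - 2) * (p - 1) / 2 * u ^ 2 * x i :=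
      fun i => by ring
    simp only [this, Finset.sum_sub_distrib, ← Finset.mul_sum, hx.sum_eq_one, ← homSum_succ]
    ring
  have e3 : (p - 2) * u * (2 * edgeDens p u) - (p - 2) * (p - 1) / 2 * u ^ 2 =
    3 * triDens p u := by unfold triDens edgeDens; ring
  have h3 := hB a x u ha hx hu hu' hc
  rw [e1, e2, hS2, e3] at hsum
  linarith

/-- The `K₄` density theorem for weighted graphs. -/
theorem k4Bound (p : ℕ) (hp : 2 ≤ p) {a : ι → ι → ℝ} {x : ι → ℝ} {u : ℝ} (ha : IsKernel a)
    (hx : IsWeight x) (hu : 1 / (p : ℝ) ≤ u) (hu' : u ≤ 1 / ((p : ℝ) - 1))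
    (hc : homSum a 2 x / 2 = edgeDens p u) : k4Dens p u ≤ homSum a 4 x / 24 := by
  by_cases hp3 : p ≤ 3
  · have h4 : 0 ≤ homSum a 4 x / 24 := div_nonneg (homSum_nonneg ha 4 hx.nonneg) (by norm_num)
    have : k4Dens p u = 0 := by interval_cases p <;> · unfold k4Dens; norm_num
    rwa [this]
  · push Not at hp3
    have hP := triangleBound (ι := ι) (p - 1) (by omega)
    rw [Nat.cast_sub (by omega), Nat.cast_one] at hP
    refine k4Bound_of_triangleBound ?_ (triangleBound p hp) hP ha hx hu hu' hc
    rcases (show 4 ≤ p from hp3).eq_or_lt with rfl | h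
    · left; norm_num
    · right; exact_mod_cast h

end Weighted

/-! ### Clique sums of graphs -/

section CliqueForm

variable {ι : Type*} [LinearOrder ι]

/-- The product of the entries of `a` over the pairs in `X`. -/
def pairProd (a : ι → ι → ℝ) (X : Finset ι) : ℝ :=
  ∏ p ∈ (X ×ˢ X).filter (fun p => p.1 < p.2), a p.1 p.2

lemma pairProd_eq (a : ι → ι → ℝ) (X : Finset ι) :
    pairProd a X = ∏ i ∈ X, ∏ j ∈ X, if i < j then a i j else 1 := by
  rw [pairProd, Finset.prod_filter, Finset.prod_product]

lemma pairProd_insert {a : ι → ι → ℝ} (ha : ∀ i j, a i j = a j i) {i : ι} {Y : Finset ι}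
    (hi : i ∉ Y) : pairProd a (insert i Y) = (∏ j ∈ Y, a i j) * pairProd a Y := by
  simp only [pairProd_eq, Finset.prod_insert hi, lt_irrefl, if_false, one_mul,
    Finset.prod_mul_distrib]
  rw [← mul_assoc, ← Finset.prod_mul_distrib]
  congr 1
  refine Finset.prod_congr rfl fun j hj => ?_
  have hij : i ≠ j := fun h => hi (h ▸ hj)
  rcases lt_or_gt_of_ne hij with h | h
  · simp [h, h.not_gt]
  · simp [h, h.not_gt, ha i j]

variable [Fintype ι]

/-- The form `L_r(a, x)` over an arbitrary finite linear order instead of `Fin n`. -/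
def cliqueForm (a : ι → ι → ℝ) (r : ℕ) (x : ι → ℝ) : ℝ :=
  ∑ X ∈ Finset.powersetCard r (Finset.univ : Finset ι), pairProd a X * ∏ i ∈ X, x i

/-- Counting the pairs of an `(r + 1)`-set and one of its elements. -/
lemma cliqueForm_succ {a : ι → ι → ℝ} (ha : ∀ i j, a i j = a j i) (hd : ∀ i, a i i = 0) (r : ℕ)
    (x : ι → ℝ) :
    ((r : ℝ) + 1) * cliqueForm a (r + 1) x = ∑ i, x i * cliqueForm a r (link a x i) := by
  obtain ⟨F, hF⟩ : ∃ F : Finset ι → ℝ, F = fun X => pairProd a X * ∏ i ∈ X, x i := ⟨_, rfl⟩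
  have h1 : ((r : ℝ) + 1) * cliqueForm a (r + 1) x =
      ∑ X ∈ Finset.powersetCard (r + 1) (univ : Finset ι), ∑ i ∈ X, F X := by
    rw [cliqueForm, Finset.mul_sum]
    refine Finset.sum_congr rfl fun X hX => ?_
    rw [Finset.sum_const, (Finset.mem_powersetCard.1 hX).2, nsmul_eq_mul, hF]
    push_cast; rfl
  have h2 : ∑ X ∈ Finset.powersetCard (r + 1) (univ : Finset ι), ∑ i ∈ X, F X =
      ∑ i, ∑ X ∈ (Finset.powersetCard (r + 1) (univ : Finset ι)).filter (i ∈ ·), F X := by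
    refine Finset.sum_comm' fun X i => ?_
    simp
  rw [h1, h2]
  refine Finset.sum_congr rfl fun i _ => ?_
  have h3 : ∑ X ∈ (Finset.powersetCard (r + 1) (univ : Finset ι)).filter (i ∈ ·), F X =
      ∑ Y ∈ (Finset.powersetCard r (univ : Finset ι)).filter (i ∉ ·), F (insert i Y) := by
    refine Finset.sum_nbij' (fun X => X.erase i) (fun Y => insert i Y) ?_ ?_ ?_ ?_ ?_
    · intro X hX
      simp only [Finset.mem_filter, Finset.mem_powersetCard, Finset.subset_univ, true_and] at hX ⊢
      exact ⟨by rw [Finset.card_erase_of_mem hX.2, hX.1]; rfl, Finset.notMem_erase i X⟩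
    · intro Y hY
      simp only [Finset.mem_filter, Finset.mem_powersetCard, Finset.subset_univ, true_and] at hY ⊢
      exact ⟨by rw [Finset.card_insert_of_notMem hY.2, hY.1], Finset.mem_insert_self i Y⟩
    · intro X hX
      exact Finset.insert_erase (Finset.mem_filter.1 hX).2
    · intro Y hY
      exact Finset.erase_insert (Finset.mem_filter.1 hY).2
    · intro X hX
      rw [Finset.insert_erase (Finset.mem_filter.1 hX).2]
  rw [h3, cliqueForm, Finset.mul_sum, Finset.sum_filter]
  refine Finset.sum_congr rfl fun Y _ => ?_
  simp only [link, Finset.prod_mul_distrib]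
  split_ifs with h
  · rw [Finset.prod_eq_zero (f := fun j => a i j) h (hd i)]; ring
  · rw [hF]
    simp only [pairProd_insert ha h, Finset.prod_insert h]
    ring

lemma homSum_eq_cliqueForm {a : ι → ι → ℝ} (ha : ∀ i j, a i j = a j i) (hd : ∀ i, a i i = 0)
    (r : ℕ) (x : ι → ℝ) : homSum a r x = r.factorial * cliqueForm a r x := by
  induction r generalizing x with
  | zero => simp [homSum, cliqueForm, pairProd]
  | succ r ih =>
    rw [homSum_succ, Nat.factorial_succ]
    push_cast
    rw [mul_right_comm, cliqueForm_succ ha hd, mul_comm, Finset.mul_sum]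
    refine Finset.sum_congr rfl fun i _ => ?_
    rw [ih]; ring

end CliqueForm

section Graph

open Classical in
/-- The adjacency matrix of `G`, as a kernel. -/
def adj {V : Type*} (G : SimpleGraph V) (v w : V) : ℝ := if G.Adj v w then 1 else 0

lemma isKernel_adj {V : Type*} (G : SimpleGraph V) : IsKernel (adj G) where
  symm v w := by
    have h := G.adj_comm v w
    by_cases h1 : G.Adj v w <;> simp [adj, h1, ← h]
  nonneg v w := by unfold adj; split_ifs <;> norm_num
  le_one v w := by unfold adj; split_ifs <;> norm_num

lemma adj_self {V : Type*} (G : SimpleGraph V) (v : V) : adj G v v = 0 := by simp [adj]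

lemma homSum_adj {V : Type*} [Fintype V] (G : SimpleGraph V) (r : ℕ) :
    homSum (adj G) r (fun _ => 1) = r.factorial * cliqueCount G r := by
  classical
  -- an arbitrary linear order, to compare with `cliqueForm`
  let e := Fintype.equivFin V
  let _ : LinearOrder V := LinearOrder.lift' e e.injective
  rw [homSum_eq_cliqueForm (isKernel_adj G).symm (adj_self G)]
  congr 1
  have h1 : ∀ X : Finset V, pairProd (adj G) X * ∏ i ∈ X, (1 : ℝ) =
      if G.IsClique (X : Set V) then 1 else 0 := by
    intro X
    rw [Finset.prod_const_one, mul_one, pairProd]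
    split_ifs with h
    · refine Finset.prod_eq_one fun p hp => ?_
      simp only [Finset.mem_filter, Finset.mem_product] at hp
      simp [adj, h hp.1.1 hp.1.2 hp.2.ne]
    · obtain ⟨v, hv, w, hw, hne, hadj⟩ : ∃ v ∈ X, ∃ w ∈ X, v ≠ w ∧ ¬ G.Adj v w := by
        by_contra! h'
        exact h fun v hv w hw hne => h' v hv w hw hne
      rcases lt_or_gt_of_ne hne with hlt | hlt
      · refine Finset.prod_eq_zero (i := (v, w)) ?_ (by simp [adj, hadj])
        simp [hv, hw, hlt]
      · refine Finset.prod_eq_zero (i := (w, v)) ?_ (by simp [adj, G.adj_comm w v, hadj])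
        simp [hv, hw, hlt]
  rw [cliqueForm]
  simp only [h1]
  rw [← Finset.sum_filter, Finset.sum_const, nsmul_eq_mul, mul_one, cliqueCount]
  congr 1
  rw [← Set.ncard_coe_finset]
  congr 1
  ext X
  simp [SimpleGraph.mem_cliqueSet_iff, SimpleGraph.isNClique_iff, and_comm]

lemma homSum_adj_two {V : Type*} [Fintype V] (G : SimpleGraph V) :
    homSum (adj G) 2 (fun _ => 1) = 2 * edgeCount G := by
  classical
  rw [homSum_two]
  have h1 : ∀ v, (1 : ℝ) * ∑ w, adj G v w * 1 = G.degree v := fun v => by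
    simp only [mul_one, one_mul, adj, Finset.sum_ite, Finset.sum_const_zero, add_zero,
      Finset.sum_const, nsmul_eq_mul]
    rw [← SimpleGraph.card_neighborFinset_eq_degree, SimpleGraph.neighborFinset_eq_filter]
  simp only [h1]
  rw [← Nat.cast_sum, SimpleGraph.sum_degrees_eq_twice_card_edges, edgeCount,
    ← SimpleGraph.coe_edgeFinset, Set.ncard_coe_finset]
  push_cast; rfl

/-- Pulling a kernel back along `f` amounts to weighting each point by the size of its fibre. -/
lemma homSum_comap {V ι : Type*} [Fintype V] [Fintype ι] [DecidableEq ι] (a : ι → ι → ℝ)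
    (f : V → ι) (r : ℕ) (z : ι → ℝ) :
    homSum (fun v w => a (f v) (f w)) r (fun v => z (f v)) =
      homSum a r (fun i => z i * (univ.filter (f · = i)).card) := by
  induction r generalizing z with
  | zero => rfl
  | succ r ih =>
    simp only [homSum]
    have h1 : ∀ v, z (f v) * homSum (fun v w => a (f v) (f w)) r
        (fun w => a (f v) (f w) * z (f w)) = (fun i => z i * homSum a r
          (fun j => a i j * z j * (univ.filter (f · = j)).card)) (f v) := fun v => by
      rw [ih fun j => a (f v) j * z j]
    rw [Finset.sum_congr rfl fun v _ => h1 v, ← Finset.sum_fiberwise univ f]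
    refine Finset.sum_congr rfl fun i _ => ?_
    rw [Finset.sum_congr rfl fun v hv => by rw [(Finset.mem_filter.1 hv).2], Finset.sum_const]
    simp only [nsmul_eq_mul, mul_assoc]; ring

lemma exists_coloring {n p : ℕ} {N : Fin p → ℕ} (hN : ∑ i, N i = n) :
    ∃ f : Fin n → Fin p, ∀ i, (univ.filter (f · = i)).card = N i := by
  have hc : Fintype.card (Fin n) = Fintype.card (Σ i, Fin (N i)) := by simp [hN]
  let e := Fintype.equivOfCardEq hc
  refine ⟨fun v => (e v).1, fun i => ?_⟩
  rw [← Fintype.card_subtype]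
  rw [Fintype.card_congr (e.subtypeEquiv (q := fun s => s.1 = i) fun v => Iff.rfl)]
  let e' : {b : Σ i, Fin (N i) // b.1 = i} ≃ Fin (N i) :=
    { toFun := fun s => s.2 ▸ s.1.2
      invFun := fun k => ⟨⟨i, k⟩, rfl⟩
      left_inv := by rintro ⟨⟨j, k⟩, rfl⟩; rfl
      right_inv := fun k => rfl }
  rw [Fintype.card_congr e', Fintype.card_fin]

lemma exists_le_edgeCount_eq {n m : ℕ} (H : SimpleGraph (Fin n)) (hm : m ≤ edgeCount H) :
    ∃ G ≤ H, edgeCount G = m := by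
  classical
  have h1 : m ≤ H.edgeFinset.card := by
    rwa [edgeCount, ← SimpleGraph.coe_edgeFinset, Set.ncard_coe_finset] at hm
  obtain ⟨s, hs, hcard⟩ := Finset.exists_subset_card_eq h1
  have hse : (s : Set (Sym2 (Fin n))) ⊆ H.edgeSet := by
    rw [← SimpleGraph.coe_edgeFinset]; exact_mod_cast hs
  refine ⟨SimpleGraph.fromEdgeSet s, ?_, ?_⟩
  · rw [← SimpleGraph.fromEdgeSet_edgeSet H]
    exact SimpleGraph.fromEdgeSet_mono hse
  · rw [edgeCount, SimpleGraph.edgeSet_fromEdgeSet, Disjoint.sdiff_eq_left, Set.ncard_coe_finset, hcard]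
    rw [Set.disjoint_left]
    intro e he hd
    exact H.not_isDiag_of_mem_edgeSet (hse he) hd

lemma cliqueCount_mono {n r : ℕ} {G H : SimpleGraph (Fin n)} (h : G ≤ H) :
    cliqueCount G r ≤ cliqueCount H r :=
  Set.ncard_le_ncard (SimpleGraph.cliqueSet_mono h) (Set.toFinite _)

end Graph

/-! ### Evaluation of `phi` -/

/-- The matrix `fullMatrix s`, read as a kernel. -/
def completeKernel (s : ℕ) (i j : Fin s) : ℝ := fullMatrix s i j

lemma homSum_completeKernel {s : ℕ} (r : ℕ) (z : Fin s → ℝ) :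
    homSum (completeKernel s) r z = r.factorial * form r (fullMatrix s) z :=
  homSum_eq_cliqueForm (fun i j => by simp [completeKernel, fullMatrix, eq_comm])
    (fun i => by simp [completeKernel, fullMatrix]) r z

lemma form_fullMatrix {s : ℕ} (r : ℕ) (z : Fin s → ℝ) :
    form r (fullMatrix s) z = ∑ X ∈ Finset.powersetCard r univ, ∏ i ∈ X, z i := by
  refine Finset.sum_congr rfl fun X _ => ?_
  rw [Finset.prod_eq_one, one_mul]
  intro p hp
  simp [fullMatrix, (Finset.mem_filter.1 hp).2.ne]

lemma form_fullMatrix_eq {s : ℕ} (hs : 1 ≤ s) (r : ℕ) {z : Fin s → ℝ} {u y : ℝ}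
    (hu : ∀ i : Fin s, (i : ℕ) + 1 < s → z i = u) (hy : ∀ i : Fin s, ¬ (i : ℕ) + 1 < s → z i = y) :
    form (r + 1) (fullMatrix s) z =
      (s - 1).choose (r + 1) * u ^ (r + 1) + (s - 1).choose r * u ^ r * y := by
  let l : Fin s := ⟨s - 1, by omega⟩
  have hl : z l = y := hy l (by simp only [l]; omega)
  have hT : ∀ i ∈ (univ : Finset (Fin s)).erase l, z i = u := fun i hi => hu i (by
    have h1 := (Finset.mem_erase.1 hi).1
    have h2 : (i : ℕ) ≠ s - 1 := fun h => h1 (Fin.ext h)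
    have := i.2
    omega)
  have hcard : ((univ : Finset (Fin s)).erase l).card = s - 1 := by
    rw [Finset.card_erase_of_mem (Finset.mem_univ l), Finset.card_univ, Fintype.card_fin]
  have hprod : ∀ (k : ℕ), ∀ X ∈ Finset.powersetCard k ((univ : Finset (Fin s)).erase l),
      ∏ i ∈ X, z i = u ^ k := fun k X hX => by
    obtain ⟨h1, h2⟩ := Finset.mem_powersetCard.1 hX
    rw [Finset.prod_congr rfl fun i hi => hT i (h1 hi), Finset.prod_const, h2]
  rw [form_fullMatrix, ← Finset.insert_erase (Finset.mem_univ l),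
    Finset.powersetCard_succ_insert (Finset.notMem_erase l univ), Finset.sum_union]
  · rw [Finset.sum_congr rfl (hprod (r + 1)), Finset.sum_const, Finset.card_powersetCard, hcard,
      nsmul_eq_mul]
    congr 1
    rw [Finset.sum_image]
    · have : ∀ X ∈ Finset.powersetCard r ((univ : Finset (Fin s)).erase l),
          ∏ i ∈ insert l X, z i = u ^ r * y := fun X hX => by
        rw [Finset.prod_insert fun h => Finset.notMem_erase l univ
          ((Finset.mem_powersetCard.1 hX).1 h), hprod r X hX, hl, mul_comm]
      rw [Finset.sum_congr rfl this, Finset.sum_const, Finset.card_powersetCard, hcard,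
        nsmul_eq_mul, mul_assoc]
    · intro X hX Y hY h
      have hX' : l ∉ X := fun h => Finset.notMem_erase l univ ((Finset.mem_powersetCard.1 hX).1 h)
      have hY' : l ∉ Y := fun h => Finset.notMem_erase l univ ((Finset.mem_powersetCard.1 hY).1 h)
      rw [← Finset.erase_insert hX', ← Finset.erase_insert hY', h]
  · rw [Finset.disjoint_left]
    intro X hX hX'
    obtain ⟨Y, -, rfl⟩ := Finset.mem_image.1 hX'
    exact Finset.notMem_erase l univ ((Finset.mem_powersetCard.1 hX).1 (Finset.mem_insert_self l Y))

lemma cast_choose_three (n : ℕ) : (n.choose 3 : ℝ) = n * (n - 1) * (n - 2) / 6 := by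
  induction n with
  | zero => simp
  | succ n ih =>
    rw [Nat.choose_succ_succ' n 2]
    push_cast
    rw [ih, Nat.cast_choose_two]; ring

lemma cast_choose_four (n : ℕ) : (n.choose 4 : ℝ) = n * (n - 1) * (n - 2) * (n - 3) / 24 := by
  induction n with
  | zero => simp
  | succ n ih =>
    rw [Nat.choose_succ_succ' n 3]
    push_cast
    rw [ih, cast_choose_three]; ring

/-- The part sizes `u, …, u, 1 - (p - 1) u`. -/
def turanVector (p : ℕ) (u : ℝ) : Fin p → ℝ := fun i =>
  if (i : ℕ) + 1 < p then u else 1 - ((p : ℝ) - 1) * u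

lemma form_turanVector {p : ℕ} (hp : 1 ≤ p) (u : ℝ) (r : ℕ) :
    form (r + 1) (fullMatrix p) (turanVector p u) = (p - 1).choose (r + 1) * u ^ (r + 1) +
      (p - 1).choose r * u ^ r * (1 - ((p : ℝ) - 1) * u) :=
  form_fullMatrix_eq hp r (fun i hi => by simp [turanVector, hi])
    (fun i hi => by simp [turanVector, hi])

lemma form_turanVector_one {p : ℕ} (hp : 1 ≤ p) (u : ℝ) :
    form 1 (fullMatrix p) (turanVector p u) = 1 := by
  rw [form_turanVector hp u 0]
  simp [Nat.cast_sub hp]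

lemma form_turanVector_two {p : ℕ} (hp : 1 ≤ p) (u : ℝ) :
    form 2 (fullMatrix p) (turanVector p u) = edgeDens p u := by
  rw [form_turanVector hp u 1, Nat.cast_choose_two]
  simp only [Nat.choose_one_right, Nat.cast_sub hp, Nat.cast_one]
  unfold edgeDens; ring

lemma form_turanVector_three {p : ℕ} (hp : 1 ≤ p) (u : ℝ) :
    form 3 (fullMatrix p) (turanVector p u) = triDens p u := by
  rw [form_turanVector hp u 2, Nat.cast_choose_two, cast_choose_three]
  simp only [Nat.cast_sub hp, Nat.cast_one]
  unfold triDens; ring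

lemma form_turanVector_four {p : ℕ} (hp : 1 ≤ p) (u : ℝ) :
    form 4 (fullMatrix p) (turanVector p u) = k4Dens p u := by
  rw [form_turanVector hp u 3, cast_choose_three, cast_choose_four]
  simp only [Nat.cast_sub hp, Nat.cast_one]
  unfold k4Dens; ring

lemma extremalVector_eq {c : ℝ} (hs : 2 ≤ xi c) :
    extremalVector c = turanVector (xi c) (partSize (xi c) c) := by
  funext i
  have : (2 : ℝ) ≤ xi c := by exact_mod_cast hs
  unfold extremalVector turanVector partSize
  split_ifs
  · rfl
  · field_simp; ring

lemma lt_xi_iff {c : ℝ} (n : ℕ) : n < xi c ↔ (n : ℝ) < 1 / (1 - 2 * c) := Nat.lt_ceil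

lemma two_le_xi {c : ℝ} (hc : 0 < c) (hc' : c < 1 / 2) : 2 ≤ xi c := by
  rw [Nat.succ_le_iff, lt_xi_iff, lt_div_iff₀ (by linarith)]
  push_cast; linarith

lemma xi_spec {c : ℝ} (hc : 0 < c) (hc' : c < 1 / 2) :
    ((xi c : ℝ) - 2) / (2 * ((xi c : ℝ) - 1)) ≤ c ∧ c ≤ ((xi c : ℝ) - 1) / (2 * (xi c : ℝ)) := by
  have h2 := two_le_xi hc hc'
  have h2' : (2 : ℝ) ≤ xi c := by exact_mod_cast h2
  have hpos : 0 < 1 - 2 * c := by linarith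
  constructor
  · have h := (lt_xi_iff (c := c) (xi c - 1)).1 (by omega)
    rw [Nat.cast_sub (by omega), Nat.cast_one, lt_div_iff₀ hpos] at h
    rw [div_le_iff₀ (by linarith)]; linarith
  · have h : 1 / (1 - 2 * c) ≤ xi c := Nat.le_ceil _
    rw [div_le_iff₀ hpos] at h
    rw [le_div_iff₀ (by linarith)]; linarith

lemma phi_eq_form {c : ℝ} (hc : 0 < c) (hc' : c < 1 / 2) (r : ℕ) :
    phi r c = form r (fullMatrix (xi c)) (turanVector (xi c) (partSize (xi c) c)) := by
  rw [phi, extremalVector_eq (two_le_xi hc hc')]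

lemma phi_three {c : ℝ} (hc : 0 < c) (hc' : c < 1 / 2) :
    phi 3 c = triDens (xi c) (partSize (xi c) c) := by
  rw [phi_eq_form hc hc', form_turanVector_three (by linarith [two_le_xi hc hc'])]

lemma phi_four {c : ℝ} (hc : 0 < c) (hc' : c < 1 / 2) :
    phi 4 c = k4Dens (xi c) (partSize (xi c) c) := by
  rw [phi_eq_form hc hc', form_turanVector_four (by linarith [two_le_xi hc hc'])]

/-- `ξ(c)` between two consecutive Turán densities. At the lower endpoint `ξ` is `p - 1`, but there the last
of the `p` parts is empty, so both descriptions of the extremal vector agree. -/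
lemma xi_eq_or {c : ℝ} (hc : 0 < c) {p : ℕ} (hp : 2 ≤ p)
    (h1 : ((p : ℝ) - 2) / (2 * ((p : ℝ) - 1)) ≤ c) (h2 : c ≤ ((p : ℝ) - 1) / (2 * (p : ℝ))) :
    xi c = p ∨ (3 ≤ p ∧ xi c = p - 1 ∧ partSize p c = 1 / ((p : ℝ) - 1) ∧
      partSize (p - 1 : ℕ) c = 1 / ((p : ℝ) - 1)) := by
  have hp' : (2 : ℝ) ≤ p := by exact_mod_cast hp
  rw [le_div_iff₀ (by linarith)] at h2
  have hpos : 0 < 1 - 2 * c := by nlinarith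
  have hle : xi c ≤ p := by
    refine Nat.ceil_le.2 ?_
    rw [div_le_iff₀ hpos]; linarith
  rcases h1.lt_or_eq with h | h
  · left
    refine le_antisymm hle ?_
    have : p - 1 < xi c := by
      rw [lt_xi_iff, Nat.cast_sub (by omega), Nat.cast_one, lt_div_iff₀ hpos]
      rw [div_lt_iff₀ (by linarith)] at h
      linarith
    omega
  · right
    have hp3 : 3 ≤ p := by
      by_contra hlt
      have : p = 2 := by omega
      rw [this] at h
      norm_num at h
      linarith
    have hp1 : (3 : ℝ) ≤ p := by exact_mod_cast hp3
    have hp1' : (0 : ℝ) < p - 1 := by linarith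
    refine ⟨hp3, ?_, ?_, ?_⟩
    · have : 1 / (1 - 2 * c) = ((p - 1 : ℕ) : ℝ) := by
        rw [Nat.cast_sub (by omega), Nat.cast_one, ← h]
        field_simp; ring
      rw [xi, this, Nat.ceil_natCast]
    · have : 1 - 2 * (p : ℝ) / (p - 1) * c = (1 / ((p : ℝ) - 1)) ^ 2 := by
        rw [← h]; field_simp; ring
      rw [partSize, this, Real.sqrt_sq (by positivity)]
      field_simp; ring
    · have hp2 : (0 : ℝ) < p - 2 := by linarith
      have : 1 - 2 * ((p : ℝ) - 1) / ((p : ℝ) - 1 - 1) * c = 0 := by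
        rw [← h, show (p : ℝ) - 1 - 1 = p - 2 by ring]; field_simp; ring
      rw [Nat.cast_sub (by omega), Nat.cast_one, partSize, this, Real.sqrt_zero]
      ring

lemma phi_three_of_mem {c : ℝ} (hc : 0 < c) {p : ℕ} (hp : 2 ≤ p)
    (h1 : ((p : ℝ) - 2) / (2 * ((p : ℝ) - 1)) ≤ c) (h2 : c ≤ ((p : ℝ) - 1) / (2 * (p : ℝ))) :
    phi 3 c = triDens p (partSize p c) := by
  have hp' : (2 : ℝ) ≤ p := by exact_mod_cast hp
  have hc' : c < 1 / 2 := by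
    rw [le_div_iff₀ (by linarith)] at h2; nlinarith
  rw [phi_three hc hc']
  rcases xi_eq_or hc hp h1 h2 with h | ⟨h3, h, h4, h5⟩
  · rw [h]
  · rw [h, h4, h5, Nat.cast_sub (by omega), Nat.cast_one,
      triDens_one_div_pred (by exact_mod_cast h3)]

lemma phi_four_of_mem {c : ℝ} (hc : 0 < c) {p : ℕ} (hp : 2 ≤ p)
    (h1 : ((p : ℝ) - 2) / (2 * ((p : ℝ) - 1)) ≤ c) (h2 : c ≤ ((p : ℝ) - 1) / (2 * (p : ℝ))) :
    phi 4 c = k4Dens p (partSize p c) := by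
  have hp' : (2 : ℝ) ≤ p := by exact_mod_cast hp
  have hc' : c < 1 / 2 := by
    rw [le_div_iff₀ (by linarith)] at h2; nlinarith
  rw [phi_four hc hc']
  rcases xi_eq_or hc hp h1 h2 with h | ⟨h3, h, h4, h5⟩
  · rw [h]
  · have h3' : (3 : ℝ) ≤ p := by exact_mod_cast h3
    have : (0 : ℝ) < p - 1 := by linarith
    rw [h, h4, h5, Nat.cast_sub (by omega), Nat.cast_one]
    unfold k4Dens; field_simp; ring

/-- The clique bounds for graphs: the weighted theorem with uniform weights `1 / n`. The other conjuncts record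
that the edge density lies in the range where `phi` is meaningful. -/
lemma phi_le_cliqueCount {V : Type*} [Fintype V] (G : SimpleGraph V) (hm : 1 ≤ edgeCount G) {r : ℕ}
    (hr : r = 3 ∨ r = 4) :
    0 < (edgeCount G : ℝ) / (Fintype.card V : ℝ) ^ 2 ∧
    (edgeCount G : ℝ) / (Fintype.card V : ℝ) ^ 2 < 1 / 2 ∧ 0 < Fintype.card V ∧
    phi r ((edgeCount G : ℝ) / (Fintype.card V : ℝ) ^ 2) * (Fintype.card V : ℝ) ^ r ≤
      cliqueCount G r := by
  classical
  have hchoose : edgeCount G ≤ (Fintype.card V).choose 2 := by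
    rw [edgeCount, ← SimpleGraph.coe_edgeFinset, Set.ncard_coe_finset]
    exact SimpleGraph.card_edgeFinset_le_card_choose_two
  obtain ⟨n, hn⟩ : ∃ n, n = Fintype.card V := ⟨_, rfl⟩
  rw [← hn] at hchoose ⊢
  have hn0 : 0 < n := by
    rcases Nat.eq_zero_or_pos n with h | h
    · rw [h] at hchoose; simp at hchoose; omega
    · exact h
  have hnR : (0 : ℝ) < n := by exact_mod_cast hn0
  have hmR : (1 : ℝ) ≤ edgeCount G := by exact_mod_cast hm
  have hcR : (edgeCount G : ℝ) ≤ n * (n - 1) / 2 := by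
    rw [← Nat.cast_choose_two]; exact_mod_cast hchoose
  have hc0 : 0 < (edgeCount G : ℝ) / (n : ℝ) ^ 2 := by positivity
  have hc1 : (edgeCount G : ℝ) / (n : ℝ) ^ 2 < 1 / 2 := by
    rw [div_lt_iff₀ (by positivity)]; nlinarith
  refine ⟨hc0, hc1, hn0, ?_⟩
  obtain ⟨c, hc⟩ : ∃ c, c = (edgeCount G : ℝ) / (n : ℝ) ^ 2 := ⟨_, rfl⟩
  rw [← hc] at hc0 hc1 ⊢
  let x : V → ℝ := fun _ => (n : ℝ)⁻¹
  have hx : IsWeight x := ⟨fun _ => by positivity, by simp [x, ← hn, hnR.ne']⟩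
  have hS : ∀ r, homSum (adj G) r x = homSum (adj G) r (fun _ => 1) / (n : ℝ) ^ r := fun r => by
    have := homSum_smul (adj G) r ((n : ℝ)⁻¹) (fun _ => (1 : ℝ))
    simp only [mul_one] at this
    rw [this, inv_pow, div_eq_inv_mul]
  have h2 := two_le_xi hc0 hc1
  have h2R : (2 : ℝ) ≤ xi c := by exact_mod_cast h2
  obtain ⟨hx1, hx2⟩ := xi_spec hc0 hc1
  have hedge : homSum (adj G) 2 x / 2 = edgeDens (xi c) (partSize (xi c) c) := by
    rw [edgeDens_partSize h2R hx2, hS, homSum_adj_two, hc]; ring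
  rcases hr with rfl | rfl
  · have := triangleBound (xi c) h2 (adj G) x _ (isKernel_adj G) hx
      (one_div_le_partSize h2R c) (partSize_le h2R hx1) hedge
    rw [hS, homSum_adj] at this
    rw [phi_three hc0 hc1, ← le_div_iff₀ (by positivity)]
    refine this.trans (le_of_eq ?_)
    norm_num [Nat.factorial]; field_simp
  · have := k4Bound (xi c) h2 (isKernel_adj G) hx
      (one_div_le_partSize h2R c) (partSize_le h2R hx1) hedge
    rw [hS, homSum_adj] at this
    rw [phi_four hc0 hc1, ← le_div_iff₀ (by positivity)]
    refine this.trans (le_of_eq ?_)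
    norm_num [Nat.factorial]; field_simp

lemma phi_mul_pow_eq {n m : ℝ} {r : ℕ} (hr : r = 3 ∨ r = 4) (hn : 0 < n) (h0 : 0 < m / n ^ 2)
    (h1 : m / n ^ 2 < 1 / 2) {s : ℕ} (hs : s = xi (m / n ^ 2)) :
    phi r (m / n ^ 2) * n ^ r = (s.choose r : ℝ) * (1 / (s : ℝ) ^ r) *
      (n - ((r : ℝ) - 1) * √(n ^ 2 - 2 * (s : ℝ) * m / ((s : ℝ) - 1))) *
      (n + √(n ^ 2 - 2 * (s : ℝ) * m / ((s : ℝ) - 1))) ^ (r - 1) := by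
  have h2 : (2 : ℝ) ≤ s := by rw [hs]; exact_mod_cast two_le_xi h0 h1
  have hs1 : (0 : ℝ) < s - 1 := by linarith
  obtain ⟨c, hc⟩ : ∃ c, c = m / n ^ 2 := ⟨_, rfl⟩
  have hsq : √(n ^ 2 - 2 * (s : ℝ) * m / ((s : ℝ) - 1)) =
      n * √(1 - 2 * (s : ℝ) / ((s : ℝ) - 1) * c) := by
    have : n ^ 2 - 2 * (s : ℝ) * m / ((s : ℝ) - 1) =
        n ^ 2 * (1 - 2 * (s : ℝ) / ((s : ℝ) - 1) * c) := by rw [hc]; field_simp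
    rw [this, Real.sqrt_mul (by positivity), Real.sqrt_sq hn.le]
  rw [hsq]
  rw [← hc] at h0 h1 hs ⊢
  rcases hr with rfl | rfl
  · rw [phi_three h0 h1, ← hs, cast_choose_three]
    unfold triDens partSize
    generalize √(1 - 2 * (s : ℝ) / ((s : ℝ) - 1) * c) = t
    push_cast; field_simp; ring
  · rw [phi_four h0 h1, ← hs, cast_choose_four]
    unfold k4Dens partSize
    generalize √(1 - 2 * (s : ℝ) / ((s : ℝ) - 1) * c) = t
    push_cast; field_simp; ring

/-- Here `ξ` is `3`, or `2` at the endpoint `m = n² / 4`, where both formulas vanish. -/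
lemma fisher {n m : ℝ} (hn : 0 < n) (h1 : n ^ 2 / 4 ≤ m) (h2 : m ≤ n ^ 2 / 3) :
    phi 3 (m / n ^ 2) * n ^ 3 =
      (9 * n * m - 2 * n ^ 3 - 2 * (n ^ 2 - 3 * m) ^ (3 / 2 : ℝ)) / 27 := by
  have hc1 : 1 / 4 ≤ m / n ^ 2 := by rw [le_div_iff₀ (by positivity)]; linarith
  have hc2 : m / n ^ 2 ≤ 1 / 3 := by rw [div_le_iff₀ (by positivity)]; linarith
  rw [phi_three_of_mem (p := 3) (by linarith) (by norm_num) (by norm_num; linarith)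
    (by norm_num; linarith)]
  have hd : 0 ≤ n ^ 2 - 3 * m := by linarith
  obtain ⟨w, hw⟩ : ∃ w, w = √(n ^ 2 - 3 * m) := ⟨_, rfl⟩
  have hw2 : w ^ 2 = n ^ 2 - 3 * m := by rw [hw, Real.sq_sqrt hd]
  have hpow : (n ^ 2 - 3 * m) ^ (3 / 2 : ℝ) = w ^ 3 := by
    rw [hw, Real.sqrt_eq_rpow, ← Real.rpow_natCast (_ ^ (1 / 2 : ℝ)) 3, ← Real.rpow_mul hd]
    norm_num
  have hsq : √(1 - 2 * ((3 : ℕ) : ℝ) / (((3 : ℕ) : ℝ) - 1) * (m / n ^ 2)) = w / n := by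
    have : 1 - 2 * ((3 : ℕ) : ℝ) / (((3 : ℕ) : ℝ) - 1) * (m / n ^ 2) =
      (n ^ 2 - 3 * m) / n ^ 2 := by norm_num; field_simp
    rw [this, Real.sqrt_div hd, Real.sqrt_sq hn.le, hw]
  rw [hpow]
  unfold triDens partSize
  rw [hsq]
  have hm : m = (n ^ 2 - w ^ 2) / 3 := by linarith
  rw [hm]
  norm_num; field_simp; ring

/-! ### Asymptotics -/

/-- Partitions of `n` into integers that are asymptotically proportional to `z`: round down, and let one part
take the rest. -/
lemma exists_partition_sizes {p : ℕ} {z : Fin p → ℝ} (hz : IsWeight z) :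
    ∃ N : ℕ → Fin p → ℕ, (∀ n, ∑ i, N n i = n) ∧
      ∀ i, Tendsto (fun n => (N n i : ℝ) / n) atTop (𝓝 (z i)) := by
  have hp : Nonempty (Fin p) := by
    by_contra h
    rw [not_nonempty_iff] at h
    have := hz.sum_eq_one
    simp at this
  obtain ⟨l⟩ := hp
  have hfl : ∀ i, Tendsto (fun n : ℕ => (⌊z i * n⌋₊ : ℝ) / n) atTop (𝓝 (z i)) := fun i =>
    (tendsto_nat_floor_mul_div_atTop (hz.nonneg i)).comp tendsto_natCast_atTop_atTop
  have hle : ∀ n : ℕ, ∑ i ∈ univ.erase l, ⌊z i * n⌋₊ ≤ n := fun n => by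
    have h1 : ((∑ i ∈ univ.erase l, ⌊z i * n⌋₊ : ℕ) : ℝ) ≤ ∑ i, z i * n := by
      push_cast
      refine le_trans (Finset.sum_le_sum fun i _ => Nat.floor_le (mul_nonneg (hz.nonneg i)
        (Nat.cast_nonneg n))) ?_
      exact Finset.sum_le_sum_of_subset_of_nonneg (Finset.erase_subset _ _)
        fun i _ _ => mul_nonneg (hz.nonneg i) (Nat.cast_nonneg n)
    rw [← Finset.sum_mul, hz.sum_eq_one, one_mul] at h1
    exact_mod_cast h1
  refine ⟨fun n i => if i = l then n - ∑ i ∈ univ.erase l, ⌊z i * n⌋₊ else ⌊z i * n⌋₊,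
    fun n => ?_, fun i => ?_⟩
  · rw [← Finset.add_sum_erase _ _ (Finset.mem_univ l)]
    rw [Finset.sum_congr rfl fun i hi => if_neg (Finset.ne_of_mem_erase hi)]
    simp only [if_true]
    exact Nat.sub_add_cancel (hle n)
  · by_cases hi : i = l
    · subst hi
      have h1 : z i = 1 - ∑ j ∈ univ.erase i, z j := by
        rw [← hz.sum_eq_one, ← Finset.add_sum_erase _ _ (Finset.mem_univ i)]; ring
      have h2 : Tendsto (fun n : ℕ => 1 - ∑ j ∈ univ.erase i, (⌊z j * n⌋₊ : ℝ) / n) atTop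
          (𝓝 (z i)) := by
        rw [h1]
        exact tendsto_const_nhds.sub (tendsto_finsetSum _ fun j _ => hfl j)
      refine h2.congr' ?_
      filter_upwards [eventually_gt_atTop 0] with n hn
      have : (n : ℝ) ≠ 0 := by exact_mod_cast hn.ne'
      simp only [if_true]
      rw [Nat.cast_sub (hle n), sub_div, div_self this, Nat.cast_sum, Finset.sum_div]
    · simpa only [hi, if_false] using hfl i

/-- Complete multipartite graphs whose part sizes are asymptotically proportional to `z` have the edge and
clique densities of the weighted complete graph. -/
lemma exists_blowup {p : ℕ} {z : Fin p → ℝ} (hz : IsWeight z) :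
    ∃ H : ∀ n, SimpleGraph (Fin n),
      Tendsto (fun n => (edgeCount (H n) : ℝ) / (n : ℝ) ^ 2) atTop
        (𝓝 (form 2 (fullMatrix p) z)) ∧
      ∀ r, Tendsto (fun n => (cliqueCount (H n) r : ℝ) / (n : ℝ) ^ r) atTop
        (𝓝 (form r (fullMatrix p) z)) := by
  obtain ⟨N, hN, hlim⟩ := exists_partition_sizes hz
  choose f hf using fun n => exists_coloring (hN n)
  let H : ∀ n, SimpleGraph (Fin n) := fun n => (⊤ : SimpleGraph (Fin p)).comap (f n)
  have hadj : ∀ n, adj (H n) = fun v w => completeKernel p (f n v) (f n w) := fun n => by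
    funext v w
    by_cases h : f n v = f n w <;> simp [adj, H, completeKernel, fullMatrix, h]
  have hS : ∀ n r, homSum (adj (H n)) r (fun _ => 1) =
      homSum (completeKernel p) r (fun i => (N n i : ℝ)) := fun n r => by
    have := homSum_comap (completeKernel p) (f n) r (fun _ => 1)
    rw [hadj, this]
    simp only [one_mul, hf]
  have hT : ∀ r, Tendsto (fun n => homSum (adj (H n)) r (fun _ => 1) / (n : ℝ) ^ r) atTop
      (𝓝 (r.factorial * form r (fullMatrix p) z)) := fun r => by
    rw [← homSum_completeKernel]
    have hc : Continuous fun y : Fin p → ℝ => homSum (completeKernel p) r y :=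
      continuous_homSum r (fun _ _ => continuous_const) fun i => continuous_apply i
    have h1 := (hc.tendsto z).comp (tendsto_pi_nhds.2 hlim)
    refine h1.congr fun n => ?_
    simp only [Function.comp_def]
    rw [hS, div_eq_inv_mul, ← inv_pow, ← homSum_smul]
    congr 1
    funext i
    rw [div_eq_inv_mul]
  refine ⟨H, ?_, fun r => ?_⟩
  · have h := (hT 2).div_const 2
    simp only [homSum_adj_two, Nat.factorial_two, Nat.cast_ofNat] at h
    rw [mul_div_cancel_left₀ _ two_ne_zero] at h
    refine h.congr fun n => ?_
    ring
  · have hr : (r.factorial : ℝ) ≠ 0 := by positivity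
    have h := (hT r).div_const (r.factorial : ℝ)
    simp only [homSum_adj] at h
    rw [mul_div_cancel_left₀ _ hr] at h
    refine h.congr fun n => ?_
    field_simp

lemma isWeight_turanVector {p : ℕ} (hp : 2 ≤ p) {u : ℝ} (hu : 0 ≤ u)
    (hu' : u ≤ 1 / ((p : ℝ) - 1)) : IsWeight (turanVector p u) where
  nonneg i := by
    have : (2 : ℝ) ≤ p := by exact_mod_cast hp
    rw [le_div_iff₀ (by linarith)] at hu'
    unfold turanVector
    split_ifs
    · exact hu
    · linarith
  sum_eq_one := by
    have h := form_turanVector_one (by omega : 1 ≤ p) u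
    have h2 := homSum_completeKernel 1 (turanVector p u)
    rw [h, homSum_one] at h2
    simpa using h2

/-- The piece that contains a right neighbourhood of `c`. -/
lemma exists_piece {c : ℝ} (hc : 0 < c) (hc' : c < 1 / 2) : ∃ p : ℕ, 2 ≤ p ∧
    ((p : ℝ) - 2) / (2 * ((p : ℝ) - 1)) ≤ c ∧ c < ((p : ℝ) - 1) / (2 * (p : ℝ)) := by
  have hpos : 0 < 1 - 2 * c := by linarith
  have h1 : 1 ≤ 1 / (1 - 2 * c) := by rw [le_div_iff₀ hpos]; linarith
  have hf : 1 ≤ ⌊1 / (1 - 2 * c)⌋₊ := Nat.le_floor (by exact_mod_cast h1)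
  have hfR : (1 : ℝ) ≤ ⌊1 / (1 - 2 * c)⌋₊ := by exact_mod_cast hf
  have h2 := Nat.floor_le (by linarith : 0 ≤ 1 / (1 - 2 * c))
  have h3 := Nat.lt_floor_add_one (1 / (1 - 2 * c))
  rw [le_div_iff₀ hpos] at h2
  rw [div_lt_iff₀ hpos] at h3
  refine ⟨⌊1 / (1 - 2 * c)⌋₊ + 1, by omega, ?_, ?_⟩
  · push_cast
    rw [div_le_iff₀ (by linarith)]; linarith
  · push_cast
    rw [lt_div_iff₀ (by linarith)]; linarith

/-- The lower bound is `phi_le_cliqueCount` and the right continuity of `phi 4`. For the upper bound, a blow-up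
of slightly larger density `d` has more than `⌈c n²⌉` edges, and deleting edges creates no cliques. -/
lemma minCliqueCount_four_asymptotics {c : ℝ} (hc : 0 < c) (hc' : c < 1 / 2) :
    Asymptotics.IsLittleO Filter.atTop
      (fun n : ℕ => (minCliqueCount 4 n ⌈c * (n : ℝ) ^ 2⌉₊ : ℝ) - phi 4 c * (n : ℝ) ^ 4)
      (fun n : ℕ => (n : ℝ) ^ 4) := by
  rw [Asymptotics.isLittleO_iff]
  intro ε hε
  obtain ⟨p, hp, hp1, hp2⟩ := exists_piece hc hc'
  have hpR : (2 : ℝ) ≤ p := by exact_mod_cast hp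
  obtain ⟨F, hF⟩ : ∃ F : ℝ → ℝ, F = fun c => k4Dens p (partSize p c) := ⟨_, rfl⟩
  have hFc : Continuous F := by
    have : Continuous (k4Dens p) := by unfold k4Dens; fun_prop
    rw [hF]; exact this.comp (continuous_partSize p)
  have hphi : ∀ c', c ≤ c' → c' ≤ ((p : ℝ) - 1) / (2 * (p : ℝ)) → phi 4 c' = F c' := by
    intro c' h1 h2
    rw [hF]; exact phi_four_of_mem (by linarith) hp (by linarith) h2
  obtain ⟨d, ⟨hd1, hd2⟩, hd3⟩ : ∃ d, d ∈ Set.Ioo c (((p : ℝ) - 1) / (2 * (p : ℝ))) ∧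
      F d < F c + ε := by
    have h1 : ∀ᶠ d in 𝓝[>] c, F d < F c + ε := nhdsWithin_le_nhds
      (hFc.continuousAt.eventually_lt_const (by linarith))
    have h2 : ∀ᶠ d in 𝓝[>] c, d ∈ Set.Ioo c (((p : ℝ) - 1) / (2 * (p : ℝ))) := Ioo_mem_nhdsGT hp2
    exact (h2.and h1).exists
  have hu1 := one_div_le_partSize hpR d
  have hu2 := partSize_le hpR (by linarith : ((p : ℝ) - 2) / (2 * ((p : ℝ) - 1)) ≤ d)
  obtain ⟨H, hHe, hHc⟩ := exists_blowup (isWeight_turanVector hp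
    (le_trans (by positivity) hu1) hu2)
  have hH4 := hHc 4
  rw [form_turanVector_two (by omega), edgeDens_partSize hpR hd2.le] at hHe
  rw [form_turanVector_four (by omega)] at hH4
  have hFd : k4Dens p (partSize p d) = F d := by rw [hF]
  rw [hFd] at hH4
  -- the edge densities tend to `c`
  have hsq : Tendsto (fun n : ℕ => (n : ℝ) ^ 2) atTop atTop :=
    (tendsto_pow_atTop two_ne_zero).comp tendsto_natCast_atTop_atTop
  have hM : Tendsto (fun n : ℕ => (⌈c * (n : ℝ) ^ 2⌉₊ : ℝ) / (n : ℝ) ^ 2) atTop (𝓝 c) :=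
    (tendsto_nat_ceil_mul_div_atTop hc.le).comp hsq
  have hlt := hM.eventually_lt hHe hd1
  have hlow := (hFc.continuousAt.tendsto.comp hM).eventually_const_lt
    (by linarith : F c - ε < F c)
  filter_upwards [hlt, hlow, hM.eventually_lt_const hp2, hH4.eventually_lt_const hd3,
    eventually_gt_atTop 0] with n h1 h2 h3 h4 hn
  have hnR : (0 : ℝ) < n := by exact_mod_cast hn
  have hn4 : (0 : ℝ) < (n : ℝ) ^ 4 := by positivity
  obtain ⟨M, hMd⟩ : ∃ M, M = ⌈c * (n : ℝ) ^ 2⌉₊ := ⟨_, rfl⟩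
  simp only [Function.comp_def] at h2
  rw [← hMd] at h1 h2 h3 ⊢
  have hcM : c ≤ (M : ℝ) / (n : ℝ) ^ 2 := by
    rw [le_div_iff₀ (by positivity), hMd]; exact Nat.le_ceil _
  have hM1 : 1 ≤ M := by rw [hMd]; exact Nat.ceil_pos.2 (by positivity)
  have hMe : M ≤ edgeCount (H n) := by
    have := (div_lt_div_iff_of_pos_right (by positivity : (0 : ℝ) < (n : ℝ) ^ 2)).1 h1
    exact_mod_cast this.le
  obtain ⟨G, hGH, hGe⟩ := exists_le_edgeCount_eq (H n) hMe
  have hne : {k : ℕ | ∃ G : SimpleGraph (Fin n), edgeCount G = M ∧ cliqueCount G 4 = k}.Nonempty :=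
    ⟨_, G, hGe, rfl⟩
  have hupper : (minCliqueCount 4 n M : ℝ) ≤ (F c + ε) * (n : ℝ) ^ 4 := by
    have ha : minCliqueCount 4 n M ≤ cliqueCount (H n) 4 :=
      (Nat.sInf_le ⟨G, hGe, rfl⟩ : minCliqueCount 4 n M ≤ cliqueCount G 4).trans
        (cliqueCount_mono hGH)
    have hb := (div_lt_iff₀ hn4).1 h4
    have : (minCliqueCount 4 n M : ℝ) ≤ cliqueCount (H n) 4 := by exact_mod_cast ha
    linarith
  have hlower : (F c - ε) * (n : ℝ) ^ 4 ≤ minCliqueCount 4 n M := by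
    obtain ⟨G', hG'e, hG'c⟩ := Nat.sInf_mem hne
    have hmin : minCliqueCount 4 n M = cliqueCount G' 4 := hG'c.symm
    have := (phi_le_cliqueCount G' (by rw [hG'e]; exact hM1) (r := 4) (Or.inr rfl)).2.2.2
    rw [Fintype.card_fin, hG'e, hphi _ hcM h3.le] at this
    rw [hmin]
    exact le_trans (mul_le_mul_of_nonneg_right h2.le hn4.le) this
  rw [Real.norm_eq_abs, Real.norm_eq_abs, abs_of_pos hn4, abs_le, hphi c le_rfl hp2.le]
  constructor <;> linarith

end CliqueDensity

end

theorem mainTheorem2 :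
    -- the lower bound, and its explicit form, for every graph with `n` vertices and `m ≥ 1` edges
    (∀ (r : ℕ), r = 3 ∨ r = 4 →
      ∀ (V : Type*) [Finite V] (G : SimpleGraph V) (n m s : ℕ),
        Nat.card V = n → CliqueDensity.edgeCount G = m → 1 ≤ m →
        s = ⌈1 / (1 - 2 * (m : ℝ) / (n : ℝ) ^ 2)⌉₊ →
        CliqueDensity.phi r ((m : ℝ) / (n : ℝ) ^ 2) * (n : ℝ) ^ r
            ≤ (CliqueDensity.cliqueCount G r : ℝ) ∧
        CliqueDensity.phi r ((m : ℝ) / (n : ℝ) ^ 2) * (n : ℝ) ^ r =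
          (s.choose r : ℝ) * (1 / (s : ℝ) ^ r) *
            ((n : ℝ) - ((r : ℝ) - 1) * √((n : ℝ) ^ 2 - 2 * (s : ℝ) * (m : ℝ) / ((s : ℝ) - 1))) *
            ((n : ℝ) + √((n : ℝ) ^ 2 - 2 * (s : ℝ) * (m : ℝ) / ((s : ℝ) - 1))) ^ (r - 1)) ∧
    -- for `r = 3` and `n² / 4 ≤ m ≤ n² / 3` the bound is Fisher's
    (∀ n m : ℕ, 1 ≤ n → (n : ℝ) ^ 2 / 4 ≤ (m : ℝ) → (m : ℝ) ≤ (n : ℝ) ^ 2 / 3 →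
      CliqueDensity.phi 3 ((m : ℝ) / (n : ℝ) ^ 2) * (n : ℝ) ^ 3 =
        (9 * (n : ℝ) * (m : ℝ) - 2 * (n : ℝ) ^ 3
          - 2 * ((n : ℝ) ^ 2 - 3 * (m : ℝ)) ^ (3 / 2 : ℝ)) / 27) ∧
    -- the asymptotics for `r = 4`
    (∀ c : ℝ, 0 < c → c < 1 / 2 →
      Asymptotics.IsLittleO Filter.atTop
        (fun n : ℕ => (CliqueDensity.minCliqueCount 4 n ⌈c * (n : ℝ) ^ 2⌉₊ : ℝ)
          - CliqueDensity.phi 4 c * (n : ℝ) ^ 4)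
        (fun n : ℕ => (n : ℝ) ^ 4)) := by
  refine ⟨?_, ?_, fun c hc hc' => CliqueDensity.minCliqueCount_four_asymptotics hc hc'⟩
  · intro r hr V _ G n m s hn hm hm1 hs
    have := Fintype.ofFinite V
    rw [Nat.card_eq_fintype_card] at hn
    subst hn hm
    obtain ⟨h0, h1, hpos, hle⟩ := CliqueDensity.phi_le_cliqueCount G hm1 hr
    refine ⟨hle, CliqueDensity.phi_mul_pow_eq hr (by exact_mod_cast hpos) h0 h1 ?_⟩
    rw [hs, CliqueDensity.xi, mul_div_assoc]
  · intro n m hn h1 h2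
    exact CliqueDensity.fisher (by exact_mod_cast hn) h1 h2
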